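/- Let $m\in\mathbb N$ and let $\mathcal E_m=\{\sigma\in\mathbb N_0^m:\sigma_1\ge\dots\ge\sigma_m\}$, with degree $|\sigma|=\sigma_1+\dots+\sigma_m$. For real $\alpha>0$ and $\kappa\in\mathcal E_m$ let $J_\kappa(t;\alpha)$, $t=(t_1,\dots,t_m)$, be the Jack polynomial: the unique symmetric polynomial that is a linear combination of monomial symmetric polynomials $m_\mu$ with $\mu\in\mathcal E_m$, $\mu\le\kappa$ in the dominance order, in which $m_\kappa$ has the coefficient $\prod_{(i,j):\,1\le j\le\kappa_i}\bigl(\#\{i'>i:\kappa_{i'}\ge j\}+1+\alpha(\kappa_i-j)\bigr)$, and which is an eigenfunction of $$D(\alpha)=\frac{\alpha}{2}\sum_{i=1}^m t_i^2\frac{\partial^2}{\partial t_i^2}+\sum_{i\ne j}\frac{t_i^2}{t_i-t_j}\frac{\partial}{\partial t_i}$$ with eigenvalue $\alpha\sum_{i}\frac{\kappa_i(\kappa_i-1)}{2}-\sum_{i}(i-1)\kappa_i+(m-1)|\kappa|$. Let $1^m=(1,\dots,1)$. The generalized binomial coefficients $\binom{\kappa}{\sigma}_\alpha$, $\kappa,\sigma\in\mathcal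 E_m$, are defined by the identity $$\frac{J_\kappa(t+1^m;\alpha)}{J_\kappa(1^m;\alpha)}=\sum_{s=0}^{|\kappa|}\ \sum_{\sigma\in\mathcal E_m,\,|\sigma|=s}\binom{\kappa}{\sigma}_\alpha\frac{J_\sigma(t;\alpha)}{J_\sigma(1^m;\alpha)},$$ and $\binom{\kappa}{\sigma}_\alpha=0$ if $|\sigma|>|\kappa|$. Theorem. For all $\kappa,\sigma\in\mathcal E_m$ and all real $\alpha>0$ these objects are well defined: $J_\kappa(\cdot;\alpha)$ exists and is unique, $J_\kappa(1^m;\alpha)>0$, and the coefficients $\binom{\kappa}{\sigma}_\alpha$ exist and are unique. Moreover $\binom{\kappa}{\sigma}_\alpha\ge 0$, and $\binom{\kappa}{\sigma}_\alpha$ is rational in the sense that there are polynomials $p,q\in\mathbb Q[x]$, depending only on $\kappa,\sigma$, with $q(\alpha)\ne0$ and $\binom{\kappa}{\sigma}_\alpha=p(\alpha)/q(\alpha)$ for all real $\alpha>0$; in particular it is a rational number whenever $\alpha$ is rational. Furthermore, writing $\sigma^i=(\sigma_1,\dots,\sigma_i+1,\dots,\sigma_m)$, the contiguous coefficients are strictly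 positive: $\binom{\sigma^i}{\sigma}_\alpha>0$ for every $\alpha>0$, $\sigma\in\mathcal E_m$ and $1\le i\le m$ with $\sigma^i\in\mathcal E_m$. -/

import Mathlib

namespace JackBinomial

/-- The non-increasing multi-indices `κ₁ ≥ κ₂ ≥ ⋯ ≥ κₘ ≥ 0` of length `m`. -/
abbrev MultiIndex (m : ℕ) : Type := {σ : Fin m → ℕ // Antitone σ}

variable {m : ℕ}

/-- The degree `|σ| = σ₁ + ⋯ + σₘ`. -/
def degree (σ : MultiIndex m) : ℕ := ∑ i, σ.1 i

open Classical in
/-- The finite set of non-increasing multi-indices of length `m` and degree `s`. -/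
noncomputable def ofDegree (m s : ℕ) : Finset (MultiIndex m) :=
  (Finset.piAntidiag (Finset.univ : Finset (Fin m)) s).subtype (fun σ => Antitone σ)

theorem mem_ofDegree {s : ℕ} {σ : MultiIndex m} : σ ∈ ofDegree m s ↔ degree σ = s := by
  simp [ofDegree, degree]

/-- The dominance order: `|μ| = |κ|` and `μ₁ + ⋯ + μ_k ≤ κ₁ + ⋯ + κ_k` for all `k`. -/
def Dominated (μ κ : MultiIndex m) : Prop :=
  degree μ = degree κ ∧ ∀ k : Fin m, ∑ i ∈ Finset.Iic k, μ.1 i ≤ ∑ i ∈ Finset.Iic k, κ.1 i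

/-- The coefficient of the monomial `t₁^{μ₁} ⋯ tₘ^{μₘ}`; for a symmetric polynomial and a
non-increasing `μ`, this is the coefficient of the monomial symmetric polynomial `m_μ`. -/
noncomputable def coeffAt (μ : Fin m → ℕ) (f : MvPolynomial (Fin m) ℝ) : ℝ :=
  f.coeff (Finsupp.equivFunOnFinite.symm μ)

/-- The value at the point `t` (with pairwise distinct coordinates) of the
Laplace-Beltrami-type operator
`D(α) = (α/2) ∑ᵢ tᵢ² ∂²/∂tᵢ² + ∑_{i ≠ j} tᵢ²/(tᵢ - tⱼ) ∂/∂tᵢ` applied to `f`. -/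
noncomputable def laplaceBeltrami (α : ℝ) (f : MvPolynomial (Fin m) ℝ) (t : Fin m → ℝ) : ℝ :=
  α / 2 *
      (∑ i, t i ^ 2 * MvPolynomial.eval t (MvPolynomial.pderiv i (MvPolynomial.pderiv i f))) +
    ∑ i, ∑ j ∈ Finset.univ.erase i,
      t i ^ 2 / (t i - t j) * MvPolynomial.eval t (MvPolynomial.pderiv i f)

/-- `e_κ(α) = α ∑ᵢ κᵢ(κᵢ - 1)/2 - ∑ᵢ (i - 1) κᵢ + (m - 1)|κ|` (with `i` running from `1` to `m`;
an index of `Fin m` is already `i - 1`). -/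
noncomputable def eigenvalue (α : ℝ) (κ : MultiIndex m) : ℝ :=
  α * (∑ i : Fin m, (κ.1 i : ℝ) * ((κ.1 i : ℝ) - 1) / 2)
    - (∑ i : Fin m, ((i : ℕ) : ℝ) * (κ.1 i : ℝ)) + ((m : ℝ) - 1) * (degree κ : ℝ)

/-- The product over the boxes of the diagram of `κ` of the lower hook-lengths
`(leg + 1) + α * arm`; the box in row `i` and column `j` (both counted from `0`) has arm
`κᵢ - (j + 1)` and leg `#{i' > i : κ_{i'} > j}`. -/
noncomputable def lowerHookProduct (α : ℝ) (κ : MultiIndex m) : ℝ :=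
  ∏ i : Fin m, ∏ j ∈ Finset.range (κ.1 i),
    (((Finset.univ.filter (fun i' : Fin m => i < i' ∧ j < κ.1 i')).card : ℝ) + 1
      + α * ((κ.1 i : ℝ) - ((j : ℝ) + 1)))

/-- `J` is the Jack polynomial `J_κ(t₁, …, tₘ; α)`: it is symmetric, it is a linear combination of
monomial symmetric polynomials `m_μ` with `μ` dominated by `κ`, the coefficient of `m_κ` is
the product of the lower hook-lengths, and it is an eigenfunction of `D(α)` with
eigenvalue `e_κ(α)`. -/
structure IsJack (α : ℝ) (κ : MultiIndex m) (J : MvPolynomial (Fin m) ℝ) : Prop where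
  symmetric : J.IsSymmetric
  triangular : ∀ μ : MultiIndex m, coeffAt μ.1 J ≠ 0 → Dominated μ κ
  leading : coeffAt κ.1 J = lowerHookProduct α κ
  eigen : ∀ t : Fin m → ℝ, Function.Injective t →
    laplaceBeltrami α J t = eigenvalue α κ * MvPolynomial.eval t J

open Classical in
/-- The Jack polynomial `J_κ(t₁, …, tₘ; α)`, as a polynomial with real coefficients, for `α > 0`. -/
noncomputable def jack (α : ℝ) (κ : MultiIndex m) : MvPolynomial (Fin m) ℝ :=
  if h : ∃ J, IsJack α κ J then h.choose else 0

/-- The value `J_κ(1, …, 1; α)`. -/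
noncomputable def jackAtOne (α : ℝ) (κ : MultiIndex m) : ℝ :=
  MvPolynomial.eval (fun _ => 1) (jack α κ)

/-- The normalized Jack polynomial `J_κ(t; α) / J_κ(1, …, 1; α)`. -/
noncomputable def normalizedJack (α : ℝ) (κ : MultiIndex m) : MvPolynomial (Fin m) ℝ :=
  (jackAtOne α κ)⁻¹ • jack α κ

/-- The polynomial `f(t₁ + 1, …, tₘ + 1)`. -/
noncomputable def shift (f : MvPolynomial (Fin m) ℝ) : MvPolynomial (Fin m) ℝ :=
  MvPolynomial.aeval (fun i => MvPolynomial.X i + 1) f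

/-- The identity that defines the generalized binomial coefficients `b σ = (κ choose σ)_α`:
`J_κ(t + 1; α) / J_κ(1; α) = ∑_{s = 0}^{|κ|} ∑_{|σ| = s} b σ * J_σ(t; α) / J_σ(1; α)`,
with `b σ = 0` for the `σ` with `|σ| > |κ|`, which do not occur on the right. -/
structure IsBinomialFamily (α : ℝ) (κ : MultiIndex m) (b : MultiIndex m → ℝ) : Prop where
  expansion : shift (normalizedJack α κ) =
    ∑ s ∈ Finset.range (degree κ + 1), ∑ σ ∈ ofDegree m s, b σ • normalizedJack α σ
  eq_zero : ∀ σ : MultiIndex m, degree κ < degree σ → b σ = 0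

open Classical in
/-- The generalized binomial coefficient `(κ choose σ)_α`, for `α > 0`. -/
noncomputable def binomial (α : ℝ) (κ σ : MultiIndex m) : ℝ :=
  if h : ∃ b, IsBinomialFamily α κ b then h.choose σ else 0

/-- `σ^i = (σ₁, …, σᵢ + 1, …, σₘ)`. -/
def raise (σ : MultiIndex m) (i : Fin m) : Fin m → ℕ :=
  Function.update σ.1 i (σ.1 i + 1)

end JackBinomial

namespace JackBinomial
open MvPolynomial
variable {m n : ℕ}

/-! ### Coefficients -/

/-! On symmetric polynomials `D(α)` is triangular for the dominance order. The coefficient of `D f`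
at `μ` is the eigenvalue of `μ` times that of `f`, plus a positive combination of coefficients of
`f` at multi-indices that arise from `μ` by enlarging the larger of two entries at the expense of
the other (`coeffAt_lbPoly'`). For `α > 0` the eigenvalue is strictly increasing in the dominance
order (`Dominated.eigenvalue_lt`), so the eigenvalue equation is a recursion that fixes all
coefficients of the Jack polynomial from its leading one. Every ingredient of the recursion is
nonnegative and rational in `α`; hence `J_κ(1) > 0`, and the coefficients are rational functions of
`α`.

Nonnegativity comes from the nonsymmetric theory. By Taylor's formula, translation by `(1, …, 1)` is
the exponential of `∑ ∂ᵢ`, so it is enough that `∑ ∂ᵢ` sends a normalized Jack polynomial to a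
nonnegative combination of normalized ones, positive at the contiguous indices
(`exists_sumDeriv_normalizedJack`). The Cherednik operators `Yᵢ` have joint eigenvectors `E_η`, one
for each composition `η`, normalized by `E_η(1) = 1`. They are built from `1` by the raising
operator `phi` and the intertwiners `sᵢ + γ`. Their joint eigenvalues are distinct, so they form a
basis. The Jack polynomial `J_κ` lies in the span of the `E_η` with `η` a rearrangement of `κ`
(`jack_mem_orbitSpan`): monomials expand triangularly in orbits, and `∑ Yᵢ²` acts on homogeneous
symmetric polynomials as an affine function of `D(α)`, which isolates the orbit of `κ`. Within the
orbit the coordinates `a_η` of `J_κ` differ by positive factors, because `|γ| < 1`, and they add up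
to `J_κ(1) > 0`; so all are positive (`repr_jack_pos`).

On symmetric polynomials the last Cherednik operator is `α tₘ ∂ₘ`, so `α tₘ ∂ₘ J_κ = ∑ a_η η̄ₘ E_η`.
Here `η̄ₘ = 0` if `ηₘ = 0`; otherwise `η̄ₘ > 0`, and `E_η` is `tₘ` times a cyclic rearrangement of
some `E_ζ` with degree one less. Cancelling `tₘ` and symmetrizing turns each `E_ζ` into `m!` times a
normalized Jack polynomial, which gives `∑ ∂ᵢ J_κ` with positive coefficients. A contiguous index
occurs because any positive entry of `κ` can be permuted to the last place.

The binomial coefficients are unique since Jack polynomials are linearly independent. They are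
rational in `α` since comparing monomial coefficients in `J_κ(t + 1)` gives a triangular linear
system with rational entries and nonvanishing diagonal. -/

theorem ext_coeffAt {f g : MvPolynomial (Fin m) ℝ} (h : ∀ μ, coeffAt μ f = coeffAt μ g) :
    f = g := by
  ext d
  have := h (Finsupp.equivFunOnFinite d)
  simpa [coeffAt] using this

theorem coeffAt_add (μ : Fin m → ℕ) (f g : MvPolynomial (Fin m) ℝ) :
    coeffAt μ (f + g) = coeffAt μ f + coeffAt μ g := coeff_add _ _ _

theorem coeffAt_sub (μ : Fin m → ℕ) (f g : MvPolynomial (Fin m) ℝ) :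
    coeffAt μ (f - g) = coeffAt μ f - coeffAt μ g := coeff_sub _ _ _ _

theorem coeffAt_smul (μ : Fin m → ℕ) (c : ℝ) (f : MvPolynomial (Fin m) ℝ) :
    coeffAt μ (c • f) = c * coeffAt μ f := by
  simp [coeffAt]

theorem coeffAt_sum {ι : Type*} (s : Finset ι) (μ : Fin m → ℕ)
    (f : ι → MvPolynomial (Fin m) ℝ) :
    coeffAt μ (∑ i ∈ s, f i) = ∑ i ∈ s, coeffAt μ (f i) := coeff_sum _ _ _

theorem coeffAt_X_mul_succ (μ : Fin m → ℕ) (i : Fin m) (p : ℕ) (f : MvPolynomial (Fin m) ℝ) :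
    coeffAt (Function.update μ i (p + 1)) (X i * f) = coeffAt (Function.update μ i p) f := by
  unfold coeffAt
  rw [← coeff_X_mul _ i f]
  congr 1
  ext j
  by_cases h : j = i
  · subst h; simp; omega
  · simp [h]

theorem coeffAt_X_mul_zero (μ : Fin m → ℕ) (i : Fin m) (h : μ i = 0)
    (f : MvPolynomial (Fin m) ℝ) : coeffAt μ (X i * f) = 0 := by
  classical
  unfold coeffAt
  rw [coeff_X_mul', if_neg]
  simp [h]

theorem coeffAt_pderiv (μ : Fin m → ℕ) (i : Fin m) (f : MvPolynomial (Fin m) ℝ) :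
    coeffAt μ (pderiv i f) = coeffAt (Function.update μ i (μ i + 1)) f * (μ i + 1) := by
  unfold coeffAt
  rw [coeff_pderiv]
  simp only [Finsupp.coe_equivFunOnFinite_symm]
  congr 2
  ext j
  by_cases h : j = i
  · subst h; simp
  · simp [h]

theorem coeffAt_X_mul_pderiv (μ : Fin m → ℕ) (i : Fin m) (f : MvPolynomial (Fin m) ℝ) :
    coeffAt μ (X i * pderiv i f) = μ i * coeffAt μ f := by
  rcases h : μ i with _ | p
  · rw [coeffAt_X_mul_zero _ _ h]; simp
  · have : μ = Function.update μ i (p + 1) := by rw [← h]; simp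
    rw [this, coeffAt_X_mul_succ, coeffAt_pderiv]
    simp [mul_comm]

theorem coeffAt_rename (w : Equiv.Perm (Fin m)) (μ : Fin m → ℕ) (f : MvPolynomial (Fin m) ℝ) :
    coeffAt μ (rename w f) = coeffAt (μ ∘ w) f := by
  unfold coeffAt
  rw [← coeff_rename_mapDomain w w.injective f]
  congr 1
  ext j
  rw [Finsupp.mapDomain_equiv_apply]
  simp

theorem coeffAt_symm {f : MvPolynomial (Fin m) ℝ} (hf : f.IsSymmetric) (w : Equiv.Perm (Fin m))
    (μ : Fin m → ℕ) : coeffAt (μ ∘ w) f = coeffAt μ f := by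
  rw [← coeffAt_rename, hf w]

theorem isSymmetric_of_coeffAt {f : MvPolynomial (Fin m) ℝ}
    (h : ∀ (w : Equiv.Perm (Fin m)) μ, coeffAt (μ ∘ w) f = coeffAt μ f) : f.IsSymmetric :=
  fun w => ext_coeffAt fun μ => by rw [coeffAt_rename, h]

/-! ### Divided differences -/

theorem X_sub_X_ne_zero {i j : Fin m} (h : i ≠ j) :
    (X i - X j : MvPolynomial (Fin m) ℝ) ≠ 0 :=
  sub_ne_zero.2 fun e => h (X_injective e)

/-- Modulo `X i - X j` the two variables coincide, so the transposition acts trivially on the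
quotient; it suffices to check this on the variables. -/
theorem X_sub_X_dvd (i j : Fin m) (f : MvPolynomial (Fin m) ℝ) :
    (X i - X j) ∣ f - rename (Equiv.swap i j) f := by
  rw [← Ideal.mem_span_singleton, ← Ideal.Quotient.eq]
  set I := Ideal.span {(X i - X j : MvPolynomial (Fin m) ℝ)}
  have : (Ideal.Quotient.mkₐ ℝ I) = (Ideal.Quotient.mkₐ ℝ I).comp (rename (Equiv.swap i j)) := by
    apply MvPolynomial.algHom_ext
    intro k
    have hij : Ideal.Quotient.mk I (X i) = Ideal.Quotient.mk I (X j) :=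
      Ideal.Quotient.eq.2 (Ideal.mem_span_singleton_self _)
    simp only [AlgHom.comp_apply, rename_X, Ideal.Quotient.mkₐ_eq_mk]
    rcases eq_or_ne k i with rfl | hi
    · simp [hij]
    rcases eq_or_ne k j with rfl | hj
    · simp [hij]
    · rw [Equiv.swap_apply_of_ne_of_ne hi hj]
  exact congrArg (fun φ => φ f) this

/-- The divided difference `(f - sᵢⱼ f) / (Xᵢ - Xⱼ)`, and `0` if `i = j`. -/
noncomputable def divDiff (i j : Fin m) :
    MvPolynomial (Fin m) ℝ →ₗ[ℝ] MvPolynomial (Fin m) ℝ :=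
  if h : i = j then 0 else
  { toFun := fun f => (X_sub_X_dvd i j f).choose
    map_add' := fun f g => mul_left_cancel₀ (X_sub_X_ne_zero h) <| by
      rw [mul_add, ← (X_sub_X_dvd i j _).choose_spec, ← (X_sub_X_dvd i j _).choose_spec,
        ← (X_sub_X_dvd i j _).choose_spec, map_add]
      ring
    map_smul' := fun c f => mul_left_cancel₀ (X_sub_X_ne_zero h) <| by
      rw [RingHom.id_apply, mul_smul_comm, ← (X_sub_X_dvd i j _).choose_spec,
        ← (X_sub_X_dvd i j _).choose_spec, map_smul, smul_sub] }

theorem X_sub_X_mul_divDiff {i j : Fin m} (h : i ≠ j) (f : MvPolynomial (Fin m) ℝ) :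
    (X i - X j) * divDiff i j f = f - rename (Equiv.swap i j) f := by
  rw [divDiff, dif_neg h]
  exact (X_sub_X_dvd i j f).choose_spec.symm

theorem divDiff_eq_iff {i j : Fin m} (h : i ≠ j) {f g : MvPolynomial (Fin m) ℝ} :
    divDiff i j f = g ↔ (X i - X j) * g = f - rename (Equiv.swap i j) f := by
  rw [← X_sub_X_mul_divDiff h]
  exact ⟨fun e => by rw [e], fun e => (mul_left_cancel₀ (X_sub_X_ne_zero h) e).symm⟩

theorem divDiff_comm (i j : Fin m) (f : MvPolynomial (Fin m) ℝ) :
    divDiff j i f = - divDiff i j f := by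
  rcases eq_or_ne i j with rfl | h
  · simp [divDiff]
  rw [divDiff_eq_iff h.symm, Equiv.swap_comm, ← X_sub_X_mul_divDiff h]
  ring

theorem divDiff_of_isSymmetric {f : MvPolynomial (Fin m) ℝ} (hf : f.IsSymmetric) (i j : Fin m) :
    divDiff i j f = 0 := by
  rcases eq_or_ne i j with rfl | h
  · simp [divDiff]
  rw [divDiff_eq_iff h, hf]
  simp

theorem rename_divDiff (w : Equiv.Perm (Fin m)) (i j : Fin m) (f : MvPolynomial (Fin m) ℝ) :
    rename w (divDiff i j f) = divDiff (w i) (w j) (rename w f) := by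
  rcases eq_or_ne i j with rfl | h
  · simp [divDiff]
  symm
  rw [divDiff_eq_iff (w.injective.ne h)]
  have := congrArg (rename w) (X_sub_X_mul_divDiff h f)
  simp only [map_mul, map_sub, rename_X, rename_rename] at this
  rw [this, rename_rename]
  congr 3
  ext k
  simp only [Function.comp_apply]
  rw [← Equiv.Perm.mul_apply, Equiv.mul_swap_eq_swap_mul, Equiv.Perm.mul_apply]

theorem divDiff_rename_swap (i j : Fin m) (f : MvPolynomial (Fin m) ℝ) :
    divDiff i j (rename (Equiv.swap i j) f) = - divDiff i j f := by
  rcases eq_or_ne i j with rfl | h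
  · simp [divDiff]
  rw [divDiff_eq_iff h, rename_rename]
  have h2 : (Equiv.swap i j : Fin m → Fin m) ∘ (Equiv.swap i j) = id := by ext; simp
  rw [h2, rename_id_apply, mul_neg, X_sub_X_mul_divDiff h]
  ring

theorem divDiff_X_mul_left {i j : Fin m} (h : i ≠ j) (f : MvPolynomial (Fin m) ℝ) :
    divDiff i j (X i * f) = X i * divDiff i j f + rename (Equiv.swap i j) f := by
  rw [divDiff_eq_iff h, mul_add, mul_left_comm, X_sub_X_mul_divDiff h]
  simp
  ring

theorem divDiff_X_mul_right {i j : Fin m} (h : i ≠ j) (f : MvPolynomial (Fin m) ℝ) :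
    divDiff i j (X j * f) = X j * divDiff i j f - rename (Equiv.swap i j) f := by
  rw [divDiff_eq_iff h, mul_sub, mul_left_comm, X_sub_X_mul_divDiff h]
  simp
  ring

theorem divDiff_X_mul_of_ne {i j k : Fin m} (hi : k ≠ i) (hj : k ≠ j)
    (f : MvPolynomial (Fin m) ℝ) :
    divDiff i j (X k * f) = X k * divDiff i j f := by
  rcases eq_or_ne i j with rfl | h
  · simp [divDiff]
  rw [divDiff_eq_iff h, mul_left_comm, X_sub_X_mul_divDiff h]
  simp [Equiv.swap_apply_of_ne_of_ne hi hj]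
  ring

/-- `μ` with its entries at `i` and `j` replaced by `a` and `b`. -/
def setTwo (μ : Fin m → ℕ) (i j : Fin m) (a b : ℕ) : Fin m → ℕ :=
  Function.update (Function.update μ i a) j b

theorem setTwo_comm (μ : Fin m → ℕ) {i j : Fin m} (h : i ≠ j) (a b : ℕ) :
    setTwo μ i j a b = setTwo μ j i b a := Function.update_comm h _ _ _

theorem setTwo_self (μ : Fin m → ℕ) (i j : Fin m) : setTwo μ i j (μ i) (μ j) = μ := by
  simp [setTwo]

theorem setTwo_apply (μ : Fin m → ℕ) (i j k : Fin m) (a b : ℕ) :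
    setTwo μ i j a b k = if k = j then b else if k = i then a else μ k := by
  simp [setTwo, Function.update_apply]

theorem setTwo_comp_swap (μ : Fin m → ℕ) {i j : Fin m} (h : i ≠ j) (a b : ℕ) :
    setTwo μ i j a b ∘ Equiv.swap i j = setTwo μ i j b a := by
  ext k
  simp only [Function.comp_apply, setTwo_apply, Equiv.swap_apply_def]
  by_cases hi : k = i
  · subst hi; simp [h]
  by_cases hj : k = j
  · subst hj; simp [hi, h]
  · simp [hi, hj]

/-- Reading `(Xᵢ - Xⱼ) g = f - sᵢⱼ f` at one exponent trades a unit of the `j`-exponent of `g` for a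
unit of the `i`-exponent. Iterating until the `j`-exponent is used up collects the sum. -/
theorem coeffAt_divDiff (μ : Fin m → ℕ) {i j : Fin m} (h : i ≠ j) (f : MvPolynomial (Fin m) ℝ)
    (p q : ℕ) :
    coeffAt (setTwo μ i j p q) (divDiff i j f) =
      ∑ b ∈ Finset.range (q + 1), (coeffAt (setTwo μ i j (p + q + 1 - b) b) f
        - coeffAt (setTwo μ i j b (p + q + 1 - b)) f) := by
  have key : ∀ p q, coeffAt (setTwo μ i j p q) (divDiff i j f) =
      coeffAt (setTwo μ i j (p + 1) q) (X j * divDiff i j f)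
      + (coeffAt (setTwo μ i j (p + 1) q) f - coeffAt (setTwo μ i j q (p + 1)) f) := by
    intro p q
    have := congrArg (coeffAt (setTwo μ i j (p + 1) q)) (X_sub_X_mul_divDiff h f)
    rw [sub_mul, coeffAt_sub, coeffAt_sub, coeffAt_rename, setTwo_comp_swap _ h] at this
    rw [← this]
    have h2 : coeffAt (setTwo μ i j (p + 1) q) (X i * divDiff i j f) =
        coeffAt (setTwo μ i j p q) (divDiff i j f) := by
      rw [setTwo_comm _ h, setTwo_comm _ h, setTwo, coeffAt_X_mul_succ, setTwo]
    rw [h2]; ring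
  induction q generalizing p with
  | zero =>
    rw [key, coeffAt_X_mul_zero _ _ (by simp [setTwo_apply])]
    simp
  | succ q ih =>
    rw [key, setTwo, coeffAt_X_mul_succ]
    have := ih (p + 1)
    rw [setTwo] at this
    rw [this, Finset.sum_range_succ _ (q + 1)]
    simp only [setTwo]
    congr 1
    · refine Finset.sum_congr rfl fun b _ => ?_
      rw [show p + 1 + q + 1 - b = p + (q + 1) + 1 - b by omega]
    · rw [show p + (q + 1) + 1 - (q + 1) = p + 1 by omega]

/-! ### The Laplace-Beltrami operator on symmetric polynomials -/

/-- Multiplication by the product of all `Xᵢ - Xⱼ` makes both sides vanish off the points with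
distinct coordinates, and that product is not a zero divisor. -/
theorem eq_of_eval_injective {f g : MvPolynomial (Fin m) ℝ}
    (h : ∀ t : Fin m → ℝ, Function.Injective t → eval t f = eval t g) : f = g := by
  have hV : (∏ p ∈ (Finset.univ : Finset (Fin m)).offDiag,
      (X p.1 - X p.2 : MvPolynomial (Fin m) ℝ)) ≠ 0 :=
    Finset.prod_ne_zero_iff.2 fun p hp => X_sub_X_ne_zero (by simpa using hp)
  refine mul_left_cancel₀ hV (MvPolynomial.funext fun t => ?_)
  by_cases ht : Function.Injective t
  · rw [map_mul, map_mul, h t ht]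
  · have : eval t (∏ p ∈ (Finset.univ : Finset (Fin m)).offDiag,
        (X p.1 - X p.2 : MvPolynomial (Fin m) ℝ)) = 0 := by
      simp only [Function.Injective, not_forall] at ht
      obtain ⟨i, j, hij, hne⟩ := ht
      rw [map_prod]
      exact Finset.prod_eq_zero (i := (i, j)) (by simpa using hne) (by simp [hij])
    rw [map_mul, map_mul, this, zero_mul, zero_mul]

theorem rename_pderiv (w : Equiv.Perm (Fin m)) (i : Fin m) (f : MvPolynomial (Fin m) ℝ) :
    rename w (pderiv i f) = pderiv (w i) (rename w f) := by
  refine ext_coeffAt fun μ => ?_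
  rw [coeffAt_rename, coeffAt_pderiv, coeffAt_pderiv, coeffAt_rename]
  congr 2
  ext k
  simp [Function.update_apply]

theorem rename_pderiv_of_isSymmetric {f : MvPolynomial (Fin m) ℝ} (hf : f.IsSymmetric)
    (w : Equiv.Perm (Fin m)) (i : Fin m) : rename w (pderiv i f) = pderiv (w i) f := by
  rw [rename_pderiv, hf]

/-- The Laplace-Beltrami operator as an operator on polynomials; it is meant for symmetric ones. -/
noncomputable def lbPoly (α : ℝ) (f : MvPolynomial (Fin m) ℝ) : MvPolynomial (Fin m) ℝ :=
  (α / 2) • (∑ i, (X i * pderiv i (X i * pderiv i f) - X i * pderiv i f)) +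
    ∑ i, ∑ j ∈ Finset.Ioi i, divDiff i j (X i * (X i * pderiv i f))

/-- For symmetric `f` the swap of `i` and `j` carries `Xᵢ² ∂ᵢ f` to `Xⱼ² ∂ⱼ f`, so the singular
terms for `(i, j)` and `(j, i)` together form one divided difference. -/
theorem eval_lbPoly (α : ℝ) {f : MvPolynomial (Fin m) ℝ} (hf : f.IsSymmetric) {t : Fin m → ℝ}
    (ht : Function.Injective t) : eval t (lbPoly α f) = laplaceBeltrami α f t := by
  unfold lbPoly laplaceBeltrami
  rw [map_add, smul_eval, map_sum, map_sum]
  congr 1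
  · congr 1
    refine Finset.sum_congr rfl fun i _ => ?_
    simp only [Derivation.leibniz, pderiv_X_self, smul_eq_mul, map_sub, map_mul, map_add, eval_X,
      map_one]
    ring
  · have := Finset.sum_sum_Ioi_add_eq_sum_sum_off_diag
      (fun j i : Fin m => t i ^ 2 / (t i - t j) * eval t (pderiv i f))
    simp only [Finset.compl_singleton] at this
    rw [← this]
    refine Finset.sum_congr rfl fun i _ => ?_
    rw [map_sum]
    refine Finset.sum_congr rfl fun j hj => ?_
    have hij : i ≠ j := (Finset.mem_Ioi.1 hj).ne
    have hne : t i - t j ≠ 0 := sub_ne_zero.2 (ht.ne hij)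
    have hne' : t j - t i ≠ 0 := sub_ne_zero.2 (ht.ne hij.symm)
    have h1 := congrArg (eval t) (X_sub_X_mul_divDiff hij (X i * (X i * pderiv i f)))
    simp only [map_mul, map_sub, rename_X, eval_X, Equiv.swap_apply_left,
      rename_pderiv_of_isSymmetric hf] at h1
    have h2 : t j ^ 2 / (t j - t i) = - (t j ^ 2 / (t i - t j)) := by
      rw [← neg_sub (t i) (t j), div_neg]
    rw [h2]
    field_simp
    rw [mul_comm, h1]
    ring

/-- By symmetry of `f` the two families in `coeffAt_divDiff` meet the same coefficients after a
shift of the index by one, with weights `μᵢ + μⱼ - b` and `-b`. The unmatched top term of the first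
family gives the diagonal entry; the unmatched term of the second is zero. -/
theorem coeffAt_divDiff_square (μ : Fin m → ℕ) {i j : Fin m} (h : i ≠ j)
    {f : MvPolynomial (Fin m) ℝ} (hf : f.IsSymmetric) :
    coeffAt μ (divDiff i j (X i * (X i * pderiv i f))) = μ i * coeffAt μ f +
      ∑ b ∈ Finset.range (μ j), ((μ i : ℝ) + μ j - 2 * b) *
        coeffAt (setTwo μ i j (μ i + μ j - b) b) f := by
  have hsucc : ∀ a b, coeffAt (setTwo μ i j (a + 1) b) (X i * (X i * pderiv i f)) =
      a * coeffAt (setTwo μ i j a b) f := by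
    intro a b
    rw [setTwo_comm _ h, setTwo, coeffAt_X_mul_succ, coeffAt_X_mul_pderiv, setTwo_comm _ h, setTwo]
    simp
  have hzero : ∀ b, coeffAt (setTwo μ i j 0 b) (X i * (X i * pderiv i f)) = 0 :=
    fun b => coeffAt_X_mul_zero _ _ (by simp [setTwo_apply, h]) _
  have hsym : ∀ a b, coeffAt (setTwo μ i j b a) f = coeffAt (setTwo μ i j a b) f := fun a b => by
    rw [← setTwo_comp_swap μ h, coeffAt_symm hf]
  generalize hp : μ i = p
  generalize hq : μ j = q
  have hμ : μ = setTwo μ i j p q := by rw [← hp, ← hq, setTwo_self]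
  conv_lhs => rw [hμ]
  rw [coeffAt_divDiff _ h, Finset.sum_sub_distrib, Finset.sum_range_succ, Finset.sum_range_succ',
    hzero]
  have e1 : ∀ b ∈ Finset.range q, coeffAt (setTwo μ i j (p + q + 1 - b) b)
      (X i * (X i * pderiv i f)) = ((p : ℝ) + q - b) * coeffAt (setTwo μ i j (p + q - b) b) f := by
    intro b hb
    have := Finset.mem_range.1 hb
    rw [show p + q + 1 - b = (p + q - b) + 1 by omega, hsucc, Nat.cast_sub (by omega)]
    push_cast; ring
  have e2 : ∀ b ∈ Finset.range q, coeffAt (setTwo μ i j (b + 1) (p + q + 1 - (b + 1)))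
      (X i * (X i * pderiv i f)) = (b : ℝ) * coeffAt (setTwo μ i j (p + q - b) b) f := by
    intro b hb
    rw [show p + q + 1 - (b + 1) = (p + q - b) by omega, hsucc, hsym]
  rw [Finset.sum_congr rfl e1, Finset.sum_congr rfl e2,
    show p + q + 1 - q = p + 1 by omega, hsucc, ← hμ, add_zero, add_sub_right_comm,
    ← Finset.sum_sub_distrib, add_comm]
  congr 1
  refine Finset.sum_congr rfl fun b _ => ?_
  ring

theorem coeffAt_lbPoly (α : ℝ) {f : MvPolynomial (Fin m) ℝ} (hf : f.IsSymmetric)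
    (μ : MultiIndex m) :
    coeffAt μ.1 (lbPoly α f) = eigenvalue α μ * coeffAt μ.1 f +
      ∑ i, ∑ j ∈ Finset.Ioi i, ∑ b ∈ Finset.range (μ.1 j), ((μ.1 i : ℝ) + μ.1 j - 2 * b) *
        coeffAt (setTwo μ.1 i j (μ.1 i + μ.1 j - b) b) f := by
  have h1 : ∀ i, ∑ j ∈ Finset.Ioi i, coeffAt μ.1 (divDiff i j (X i * (X i * pderiv i f))) =
      ((m : ℝ) - 1 - (i : ℕ)) * μ.1 i * coeffAt μ.1 f +
        ∑ j ∈ Finset.Ioi i, ∑ b ∈ Finset.range (μ.1 j), ((μ.1 i : ℝ) + μ.1 j - 2 * b) *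
        coeffAt (setTwo μ.1 i j (μ.1 i + μ.1 j - b) b) f := by
    intro i
    rw [Finset.sum_congr rfl fun j hj =>
      coeffAt_divDiff_square μ.1 (Finset.mem_Ioi.1 hj).ne hf, Finset.sum_add_distrib]
    congr 1
    rw [Finset.sum_const, Fin.card_Ioi, nsmul_eq_mul, Nat.cast_sub (by have := i.2; omega),
      Nat.cast_sub (by have := i.2; omega)]
    push_cast; ring
  unfold lbPoly
  rw [coeffAt_add, coeffAt_smul, coeffAt_sum, coeffAt_sum]
  simp only [coeffAt_sum, coeffAt_sub, coeffAt_X_mul_pderiv, h1]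
  rw [Finset.sum_add_distrib, ← add_assoc, eigenvalue, degree]
  congr 1
  push_cast
  simp only [Finset.mul_sum, ← Finset.sum_sub_distrib, ← Finset.sum_add_distrib, Finset.sum_mul]
  refine Finset.sum_congr rfl fun i _ => ?_
  ring

/-! ### Sorting and the dominance order -/

theorem exists_antitone_comp (η : Fin m → ℕ) : ∃ w : Equiv.Perm (Fin m), Antitone (η ∘ w) :=
  ⟨Tuple.sort (OrderDual.toDual ∘ η), fun _ _ h =>
    Tuple.monotone_sort (OrderDual.toDual ∘ η) h⟩

/-- The non-increasing rearrangement of `η`. -/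
noncomputable def sorted (η : Fin m → ℕ) : MultiIndex m :=
  ⟨η ∘ (exists_antitone_comp η).choose, (exists_antitone_comp η).choose_spec⟩

theorem exists_sorted_eq (η : Fin m → ℕ) : ∃ w : Equiv.Perm (Fin m), (sorted η).1 = η ∘ w :=
  ⟨_, rfl⟩

theorem sorted_eq_of_comp {η : Fin m → ℕ} {κ : MultiIndex m} {w : Equiv.Perm (Fin m)}
    (h : η ∘ w = κ.1) : sorted η = κ := by
  obtain ⟨v, hv⟩ := exists_sorted_eq η
  apply Subtype.ext
  rw [hv, ← h]
  exact Tuple.unique_antitone (hv ▸ (sorted η).2) (h ▸ κ.2)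

theorem sorted_comp (η : Fin m → ℕ) (w : Equiv.Perm (Fin m)) : sorted (η ∘ w) = sorted η := by
  obtain ⟨v, hv⟩ := exists_sorted_eq η
  refine sorted_eq_of_comp (w := w⁻¹ * v) ?_
  rw [hv]
  ext i
  simp

theorem sorted_self (κ : MultiIndex m) : sorted κ.1 = κ :=
  sorted_eq_of_comp (w := 1) rfl

theorem exists_comp_eq_of_sorted_eq {η ζ : Fin m → ℕ} (h : sorted η = sorted ζ) :
    ∃ w : Equiv.Perm (Fin m), η = ζ ∘ w := by
  obtain ⟨v, hv⟩ := exists_sorted_eq η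
  obtain ⟨u, hu⟩ := exists_sorted_eq ζ
  rw [h, hu] at hv
  refine ⟨u * v⁻¹, ?_⟩
  ext i
  have := congrFun hv (v⁻¹ i)
  simpa using this.symm

theorem degree_sorted (η : Fin m → ℕ) : degree (sorted η) = ∑ i, η i := by
  obtain ⟨w, hw⟩ := exists_sorted_eq η
  rw [degree, hw]
  exact Equiv.sum_comp w η

theorem sum_sq_sorted (η : Fin m → ℕ) : ∑ i, (sorted η).1 i ^ 2 = ∑ i, η i ^ 2 := by
  obtain ⟨w, hw⟩ := exists_sorted_eq η
  rw [hw]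
  exact Equiv.sum_comp w (fun i => η i ^ 2)

theorem coeffAt_sorted {f : MvPolynomial (Fin m) ℝ} (hf : f.IsSymmetric) (η : Fin m → ℕ) :
    coeffAt (sorted η).1 f = coeffAt η f := by
  obtain ⟨w, hw⟩ := exists_sorted_eq η
  rw [hw, coeffAt_symm hf]

/-! ### Partial sums of rearrangements and transfers between entries -/

theorem sum_le_sum_Iic_of_antitone {g : Fin m → ℕ} (hg : Antitone g) (k : Fin m)
    {S : Finset (Fin m)} (hS : S.card = (Finset.Iic k).card) :
    ∑ i ∈ S, g i ≤ ∑ i ∈ Finset.Iic k, g i := by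
  have h1 : ∀ i ∈ S \ Finset.Iic k, g i ≤ g k := fun i hi => hg (by
    simp only [Finset.mem_sdiff, Finset.mem_Iic, not_le] at hi
    exact hi.2.le)
  have h2 : ∀ i ∈ Finset.Iic k \ S, g k ≤ g i := fun i hi => hg (by
    simp only [Finset.mem_sdiff, Finset.mem_Iic] at hi
    exact hi.1)
  have h3 : (S \ Finset.Iic k).card = (Finset.Iic k \ S).card := Finset.card_sdiff_comm hS
  have h4 := Finset.sum_le_card_nsmul _ _ _ h1
  have h5 := Finset.card_nsmul_le_sum _ _ _ h2
  rw [← Finset.sum_inter_add_sum_sdiff S (Finset.Iic k),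
    ← Finset.sum_inter_add_sum_sdiff (Finset.Iic k) S, Finset.inter_comm]
  rw [h3] at h4
  exact Nat.add_le_add_left (h4.trans h5) _

/-- Together with `exists_sum_eq_sum_Iic_sorted` this describes a partial sum of the sorted sequence
as a maximum over subsets of the given size, so dominance can be proved without tracking how a
transfer changes the sorting. -/
theorem sum_le_sum_Iic_sorted (η : Fin m → ℕ) (k : Fin m)
    {S : Finset (Fin m)} (hS : S.card = (Finset.Iic k).card) :
    ∑ i ∈ S, η i ≤ ∑ i ∈ Finset.Iic k, (sorted η).1 i := by
  obtain ⟨w, hw⟩ := exists_sorted_eq η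
  have := sum_le_sum_Iic_of_antitone (sorted η).2 k (S := S.map w.symm.toEmbedding)
    (by rw [Finset.card_map, hS])
  rw [Finset.sum_map] at this
  simpa [hw] using this

theorem exists_sum_eq_sum_Iic_sorted (η : Fin m → ℕ) (k : Fin m) :
    ∃ S : Finset (Fin m), S.card = (Finset.Iic k).card ∧
      ∑ i ∈ S, η i = ∑ i ∈ Finset.Iic k, (sorted η).1 i := by
  obtain ⟨w, hw⟩ := exists_sorted_eq η
  refine ⟨(Finset.Iic k).map w.toEmbedding, by simp, ?_⟩
  rw [Finset.sum_map, hw]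
  rfl

theorem Dominated.refl (μ : MultiIndex m) : Dominated μ μ := ⟨rfl, fun _ => le_rfl⟩

theorem Dominated.trans {μ ν κ : MultiIndex m} (h : Dominated μ ν) (hνκ : Dominated ν κ) :
    Dominated μ κ := ⟨h.1.trans hνκ.1, fun k => le_trans (h.2 k) (hνκ.2 k)⟩

/-- A transfer between two entries that increases the larger one goes up in the dominance order. -/
theorem dominated_of_transfer {ρ ν : Fin m → ℕ} {i j : Fin m} (hij : i ≠ j)
    (hoff : ∀ k, k ≠ i → k ≠ j → ν k = ρ k) (hsum : ν i + ν j = ρ i + ρ j)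
    (hi : ρ i ≤ ν i) (hj : ρ j ≤ ν i) :
    Dominated (sorted ρ) (sorted ν) := by
  have hsplit : ∀ (S : Finset (Fin m)), ∑ k ∈ S \ {i, j}, ν k = ∑ k ∈ S \ {i, j}, ρ k := by
    intro S
    refine Finset.sum_congr rfl fun k hk => ?_
    simp only [Finset.mem_sdiff, Finset.mem_insert, Finset.mem_singleton, not_or] at hk
    exact hoff k hk.2.1 hk.2.2
  constructor
  · rw [degree_sorted, degree_sorted, ← Finset.sum_inter_add_sum_sdiff Finset.univ {i, j} ν,
      ← Finset.sum_inter_add_sum_sdiff Finset.univ {i, j} ρ, hsplit, Finset.univ_inter,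
      Finset.sum_pair hij, Finset.sum_pair hij, hsum]
  · intro k
    obtain ⟨S, hS, hsumS⟩ := exists_sum_eq_sum_Iic_sorted ρ k
    rw [← hsumS]
    by_cases hjS : j ∈ S
    · by_cases hiS : i ∈ S
      · refine le_trans (le_of_eq ?_) (sum_le_sum_Iic_sorted ν k hS)
        have : S ∩ {i, j} = {i, j} := Finset.inter_eq_right.2 (by
          intro x; simp only [Finset.mem_insert, Finset.mem_singleton]; rintro (rfl | rfl) <;>
            assumption)
        rw [← Finset.sum_inter_add_sum_sdiff S {i, j} ν,
          ← Finset.sum_inter_add_sum_sdiff S {i, j} ρ, hsplit, this, Finset.sum_pair hij,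
          Finset.sum_pair hij, hsum]
      -- If `S` contains `j` but not `i`, exchanging `j` for `i` keeps the size and cannot decrease
      -- the sum, since `ρ j ≤ ν i`.
      · refine le_trans ?_ (sum_le_sum_Iic_sorted ν k (S := insert i (S.erase j)) ?_)
        · rw [Finset.sum_insert (by simp [hiS]), ← Finset.add_sum_erase S ρ hjS]
          refine add_le_add hj (le_of_eq (Finset.sum_congr rfl fun x hx => ?_))
          simp only [Finset.mem_erase] at hx
          exact (hoff x (fun h => hiS (h ▸ hx.2)) hx.1).symm
        · rw [Finset.card_insert_of_notMem (by simp [hiS]), Finset.card_erase_add_one hjS, hS]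
    · refine le_trans (Finset.sum_le_sum fun x hx => ?_) (sum_le_sum_Iic_sorted ν k hS)
      rcases eq_or_ne x i with rfl | hxi
      · exact hi
      · exact (hoff x hxi (fun h => hjS (h ▸ hx))).symm.le

/-- Convexity of the square. The strict growth of the sum of squares is what makes the recursions
along the dominance order terminate. -/
theorem sum_sq_lt_of_transfer {ρ ν : Fin m → ℕ} {i j : Fin m} (hij : i ≠ j)
    (hoff : ∀ k, k ≠ i → k ≠ j → ν k = ρ k) (hsum : ν i + ν j = ρ i + ρ j)
    (hi : ρ i < ν i) (hj : ρ j < ν i) :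
    ∑ k, ρ k ^ 2 < ∑ k, ν k ^ 2 := by
  rw [← Finset.sum_inter_add_sum_sdiff Finset.univ {i, j} (fun k => ρ k ^ 2),
    ← Finset.sum_inter_add_sum_sdiff Finset.univ {i, j} (fun k => ν k ^ 2), Finset.univ_inter,
    Finset.sum_pair hij, Finset.sum_pair hij]
  have : ∑ k ∈ Finset.univ \ {i, j}, ν k ^ 2 = ∑ k ∈ Finset.univ \ {i, j}, ρ k ^ 2 := by
    refine Finset.sum_congr rfl fun k hk => ?_
    simp only [Finset.mem_sdiff, Finset.mem_insert, Finset.mem_singleton, not_or] at hk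
    rw [hoff k hk.2.1 hk.2.2]
  rw [this]
  apply Nat.add_lt_add_right
  -- With `a + 1` units transferred and `ρ i = ν j + c + 1`, the sum of squares gains `2 (a + 1) (c
  -- + 1)`.
  obtain ⟨a, ha⟩ := Nat.exists_eq_add_of_lt hi
  have hb : ρ j = ν j + a + 1 := by omega
  obtain ⟨c, hc⟩ := Nat.exists_eq_add_of_lt (show ν j < ρ i by omega)
  rw [hb, ha, hc]
  nlinarith [Nat.zero_le (a * c)]

/-- Summation by parts. -/
theorem sum_mul_nonneg_of_antitone {w d : Fin m → ℝ} (hw : Antitone w)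
    (hd : ∀ k, 0 ≤ ∑ i ∈ Finset.Iic k, d i) (h0 : ∑ i, d i = 0) : 0 ≤ ∑ i, w i * d i := by
  rcases m with _ | n
  · simp
  -- The consecutive differences of `w` telescope. Subtracting the last value of `w` costs nothing
  -- because the `d i` add up to zero.
  have hswap : ∀ i : Fin (n + 1), w i - w (Fin.last n) =
      ∑ k ∈ Finset.univ.filter (fun k : Fin n => i ≤ k.castSucc), (w k.castSucc - w k.succ) := by
    intro i
    induction i using Fin.reverseInduction with
    | last =>
      rw [Finset.sum_eq_zero, sub_self]
      intro k hk
      simp only [Finset.mem_filter, Fin.last_le_iff] at hk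
      exact absurd hk.2 (Fin.castSucc_lt_last k).ne
    | cast i ih =>
      have : Finset.univ.filter (fun k : Fin n => i.castSucc ≤ k.castSucc) =
          insert i (Finset.univ.filter (fun k : Fin n => i.succ ≤ k.castSucc)) := by
        ext k
        simp only [Finset.mem_filter, Finset.mem_insert, Finset.mem_univ, true_and, Fin.le_def,
          Fin.val_castSucc, Fin.val_succ, Fin.ext_iff]
        omega
      rw [this, Finset.sum_insert (by simp [Fin.le_def]), ← ih]
      ring
  have : ∑ i, w i * d i = ∑ k : Fin n, (w k.castSucc - w k.succ) *
      ∑ i ∈ Finset.Iic k.castSucc, d i := by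
    calc ∑ i, w i * d i = ∑ i, (w i - w (Fin.last n)) * d i := by
          simp only [sub_mul, Finset.sum_sub_distrib, ← Finset.mul_sum, h0, mul_zero, sub_zero]
      _ = ∑ i, ∑ k : Fin n, if i ≤ k.castSucc then (w k.castSucc - w k.succ) * d i else 0 := by
          refine Finset.sum_congr rfl fun i _ => ?_
          rw [hswap i, Finset.sum_mul, Finset.sum_filter]
      _ = _ := by
          rw [Finset.sum_comm]
          refine Finset.sum_congr rfl fun k _ => ?_
          rw [← Finset.sum_filter, Finset.mul_sum]
          refine Finset.sum_congr ?_ fun _ _ => rfl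
          ext; simp
  rw [this]
  exact Finset.sum_nonneg fun k _ =>
    mul_nonneg (sub_nonneg.2 (hw (Fin.castSucc_lt_succ).le)) (hd _)

theorem Dominated.sum_mul_le {μ κ : MultiIndex m} (h : Dominated μ κ) {w : Fin m → ℝ}
    (hw : Antitone w) : ∑ i, w i * (μ.1 i : ℝ) ≤ ∑ i, w i * (κ.1 i : ℝ) := by
  have := sum_mul_nonneg_of_antitone (d := fun i => (κ.1 i : ℝ) - μ.1 i) hw
    (fun k => by
      rw [Finset.sum_sub_distrib, sub_nonneg]
      exact_mod_cast h.2 k)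
    (by
      rw [Finset.sum_sub_distrib, sub_eq_zero]
      exact_mod_cast h.1.symm)
  simp only [mul_sub, Finset.sum_sub_distrib] at this
  linarith

/-- Summation by parts with the weight `μ` itself gives `⟨μ, μ⟩ ≤ ⟨μ, κ⟩`; then `|κ|² - |μ|² ≥ |κ -
μ|² > 0` for the Euclidean norm. -/
theorem Dominated.sum_sq_lt {μ κ : MultiIndex m} (h : Dominated μ κ) (hne : μ ≠ κ) :
    ∑ i, μ.1 i ^ 2 < ∑ i, κ.1 i ^ 2 := by
  have h1 := h.sum_mul_le (w := fun i => (μ.1 i : ℝ)) fun i j hij => by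
    have := μ.2 hij
    simpa using this
  have h2 : 0 < ∑ i, ((κ.1 i : ℝ) - μ.1 i) ^ 2 := by
    obtain ⟨i, hi⟩ := Function.ne_iff.1 (fun e => hne (Subtype.ext e))
    refine Finset.sum_pos' (fun _ _ => sq_nonneg _) ⟨i, Finset.mem_univ _, ?_⟩
    have : (κ.1 i : ℝ) - μ.1 i ≠ 0 := sub_ne_zero.2 (by exact_mod_cast Ne.symm hi)
    positivity
  have h3 : ∑ i, ((κ.1 i : ℝ) - μ.1 i) ^ 2 = ∑ i, (κ.1 i : ℝ) ^ 2 - ∑ i, (μ.1 i : ℝ) ^ 2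
      - 2 * (∑ i, (μ.1 i : ℝ) * κ.1 i - ∑ i, (μ.1 i : ℝ) * μ.1 i) := by
    simp only [Finset.mul_sum, ← Finset.sum_sub_distrib]
    exact Finset.sum_congr rfl fun i _ => by ring
  have : (∑ i, (μ.1 i : ℝ) ^ 2) < ∑ i, (κ.1 i : ℝ) ^ 2 := by linarith
  exact_mod_cast this

/-- The quadratic part grows strictly by `Dominated.sum_sq_lt`, the linear part grows weakly by
summation by parts with the decreasing weight `-i`, and the degrees agree. -/
theorem Dominated.eigenvalue_lt {μ κ : MultiIndex m} (h : Dominated μ κ) (hne : μ ≠ κ) {α : ℝ}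
    (hα : 0 < α) : eigenvalue α μ < eigenvalue α κ := by
  have h1 := h.sum_mul_le (w := fun i => -((i : ℕ) : ℝ)) fun i j hij => by
    simpa using hij
  have h2 : (∑ i, (μ.1 i : ℝ) ^ 2) < ∑ i, (κ.1 i : ℝ) ^ 2 := by exact_mod_cast h.sum_sq_lt hne
  have h3 : (∑ i, (μ.1 i : ℝ)) = ∑ i, (κ.1 i : ℝ) := by exact_mod_cast h.1
  have h4 : ∀ ν : MultiIndex m, (∑ i, (ν.1 i : ℝ) * ((ν.1 i : ℝ) - 1) / 2) =
      ((∑ i, (ν.1 i : ℝ) ^ 2) - ∑ i, (ν.1 i : ℝ)) / 2 := fun ν => by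
    rw [← Finset.sum_sub_distrib, Finset.sum_div]
    exact Finset.sum_congr rfl fun i _ => by ring
  unfold eigenvalue
  rw [h.1, h4, h4, h3]
  simp only [neg_mul, Finset.sum_neg_distrib] at h1
  have := mul_lt_mul_of_pos_left h2 hα
  linarith

theorem Dominated.antisymm {μ κ : MultiIndex m} (h : Dominated μ κ) (h' : Dominated κ μ) :
    μ = κ := by
  by_contra hne
  exact lt_asymm (h.sum_sq_lt hne) (h'.sum_sq_lt (Ne.symm hne))

/-! ### Existence and uniqueness of Jack polynomials -/

/-- The part of the Laplace-Beltrami operator above the diagonal, in terms of coefficients of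
monomial symmetric polynomials. -/
noncomputable def raiseSum (c : MultiIndex m → ℝ) (μ : MultiIndex m) : ℝ :=
  ∑ i, ∑ j ∈ Finset.Ioi i, ∑ b ∈ Finset.range (μ.1 j), ((μ.1 i : ℝ) + μ.1 j - 2 * b) *
    c (sorted (setTwo μ.1 i j (μ.1 i + μ.1 j - b) b))

section setTwo
variable {μ : MultiIndex m} {i j : Fin m} {b : ℕ}

theorem dominated_sorted_setTwo (hij : i < j) (hb : b < μ.1 j) :
    Dominated μ (sorted (setTwo μ.1 i j (μ.1 i + μ.1 j - b) b)) := by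
  have := μ.2 hij.le
  have h := dominated_of_transfer (ρ := μ.1) (ν := setTwo μ.1 i j (μ.1 i + μ.1 j - b) b) hij.ne
    (fun k hi hj => by simp [setTwo_apply, hi, hj])
    (by simp [setTwo_apply, hij.ne]; omega)
    (by simp [setTwo_apply, hij.ne]; omega)
    (by simp [setTwo_apply, hij.ne]; omega)
  rwa [sorted_self] at h

theorem sum_sq_lt_sorted_setTwo (hij : i < j) (hb : b < μ.1 j) :
    ∑ k, μ.1 k ^ 2 < ∑ k, (sorted (setTwo μ.1 i j (μ.1 i + μ.1 j - b) b)).1 k ^ 2 := by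
  have := μ.2 hij.le
  rw [sum_sq_sorted]
  exact sum_sq_lt_of_transfer hij.ne
    (fun k hi hj => by simp [setTwo_apply, hi, hj])
    (by simp [setTwo_apply, hij.ne]; omega)
    (by simp [setTwo_apply, hij.ne]; omega)
    (by simp [setTwo_apply, hij.ne]; omega)

end setTwo

theorem sum_sq_le_degree_sq (μ : MultiIndex m) : ∑ k, μ.1 k ^ 2 ≤ degree μ ^ 2 := by
  rw [degree, sq, Finset.sum_mul]
  refine Finset.sum_le_sum fun k _ => ?_
  rw [sq]
  exact Nat.mul_le_mul_left _ (Finset.single_le_sum (fun _ _ => Nat.zero_le _) (Finset.mem_univ k))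

/-- A transfer keeps the degree and increases the sum of squares; the bound `sum_sq_le_degree_sq`
prevents the truncated subtraction from spoiling strictness. -/
theorem raise_measure_lt {μ : MultiIndex m} {i j : Fin m} {b : ℕ} (hij : i < j) (hb : b < μ.1 j) :
    degree (sorted (setTwo μ.1 i j (μ.1 i + μ.1 j - b) b)) ^ 2 -
      ∑ k, (sorted (setTwo μ.1 i j (μ.1 i + μ.1 j - b) b)).1 k ^ 2 <
      degree μ ^ 2 - ∑ k, μ.1 k ^ 2 := by
  have h1 := sum_sq_lt_sorted_setTwo hij hb
  have h2 := sum_sq_le_degree_sq (sorted (setTwo μ.1 i j (μ.1 i + μ.1 j - b) b))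
  rw [← (dominated_sorted_setTwo hij hb).1] at h2 ⊢
  omega

/-- Induction on multi-indices from above with respect to transfers. -/
theorem raise_induction {P : MultiIndex m → Prop}
    (h : ∀ μ, (∀ i j b, i < j → b < μ.1 j →
      P (sorted (setTwo μ.1 i j (μ.1 i + μ.1 j - b) b))) → P μ) (μ : MultiIndex m) : P μ := by
  induction hN : degree μ ^ 2 - ∑ k, μ.1 k ^ 2 using Nat.strong_induction_on generalizing μ with
  | _ N ih =>
    subst hN
    exact h μ fun i j b hij hb => ih _ (raise_measure_lt hij hb) _ rfl

open Classical in
/-- The coefficients of the Jack polynomial, defined by recursion down the dominance order. -/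
noncomputable def jackCoeff (α : ℝ) (κ : MultiIndex m) (μ : MultiIndex m) : ℝ :=
  if μ = κ then lowerHookProduct α κ else
  if Dominated μ κ then
    (eigenvalue α κ - eigenvalue α μ)⁻¹ *
      ∑ i, ∑ j ∈ (Finset.Ioi i).attach, ∑ b ∈ (Finset.range (μ.1 j)).attach,
        ((μ.1 i : ℝ) + μ.1 j - 2 * b) *
          jackCoeff α κ (sorted (setTwo μ.1 i j (μ.1 i + μ.1 j - b) b))
  else 0
termination_by degree μ ^ 2 - ∑ k, μ.1 k ^ 2
decreasing_by exact raise_measure_lt (Finset.mem_Ioi.1 j.2) (Finset.mem_range.1 b.2)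

theorem jackCoeff_self (α : ℝ) (κ : MultiIndex m) :
    jackCoeff α κ κ = lowerHookProduct α κ := by
  rw [jackCoeff, if_pos rfl]

theorem jackCoeff_of_ne {α : ℝ} {κ μ : MultiIndex m} (hne : μ ≠ κ) (h : Dominated μ κ) :
    jackCoeff α κ μ = (eigenvalue α κ - eigenvalue α μ)⁻¹ * raiseSum (jackCoeff α κ) μ := by
  rw [jackCoeff, if_neg hne, if_pos h, raiseSum]
  congr 1
  refine Finset.sum_congr rfl fun i _ => ?_
  rw [← Finset.sum_attach (Finset.Ioi i)]
  refine Finset.sum_congr rfl fun j _ => ?_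
  rw [← Finset.sum_attach (Finset.range (μ.1 j))]

theorem jackCoeff_of_not_dominated {α : ℝ} {κ μ : MultiIndex m} (h : ¬ Dominated μ κ) :
    jackCoeff α κ μ = 0 := by
  rw [jackCoeff, if_neg (fun e : μ = κ => h (e ▸ Dominated.refl _)), if_neg h]

theorem raiseSum_eq_zero {c : MultiIndex m → ℝ} {μ : MultiIndex m}
    (h : ∀ ν, Dominated μ ν → ν ≠ μ → c ν = 0) : raiseSum c μ = 0 := by
  refine Finset.sum_eq_zero fun i _ => Finset.sum_eq_zero fun j hj =>
    Finset.sum_eq_zero fun b hb => ?_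
  rw [Finset.mem_Ioi] at hj
  rw [Finset.mem_range] at hb
  rw [h _ (dominated_sorted_setTwo hj hb), mul_zero]
  intro e
  have := sum_sq_lt_sorted_setTwo hj hb
  rw [e] at this
  exact lt_irrefl _ this

/-- Below `κ` this is the recursion cleared of its denominator. At `κ`, and at indices not dominated
by `κ`, the transfers reach only indices not dominated by `κ`, where the coefficients vanish. -/
theorem jackCoeff_eigen {α : ℝ} (hα : 0 < α) (κ μ : MultiIndex m) :
    eigenvalue α μ * jackCoeff α κ μ + raiseSum (jackCoeff α κ) μ =
      eigenvalue α κ * jackCoeff α κ μ := by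
  by_cases h : Dominated μ κ
  · rcases eq_or_ne μ κ with rfl | hne
    · rw [raiseSum_eq_zero, add_zero]
      exact fun ν hν hne => jackCoeff_of_not_dominated fun h' => hne (h'.antisymm hν)
    · have := h.eigenvalue_lt hne hα
      rw [jackCoeff_of_ne hne h]
      have : eigenvalue α κ - eigenvalue α μ ≠ 0 := by linarith
      field_simp
      ring
  · rw [jackCoeff_of_not_dominated h, raiseSum_eq_zero]
    · simp
    · exact fun ν hν _ => jackCoeff_of_not_dominated fun h' => h (hν.trans h')

theorem lowerHookProduct_pos {α : ℝ} (hα : 0 < α) (κ : MultiIndex m) :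
    0 < lowerHookProduct α κ := by
  refine Finset.prod_pos fun i _ => Finset.prod_pos fun j hj => ?_
  have : ((j : ℝ) + 1) ≤ κ.1 i := by exact_mod_cast Finset.mem_range.1 hj
  have := mul_nonneg hα.le (sub_nonneg.2 this)
  positivity

/-- The eigenvalue gap is positive, and the weights `μᵢ + μⱼ - 2b` are nonnegative because `b < μⱼ ≤
μᵢ`; so nonnegativity descends from the leading coefficient. -/
theorem jackCoeff_nonneg {α : ℝ} (hα : 0 < α) (κ μ : MultiIndex m) : 0 ≤ jackCoeff α κ μ := by
  induction μ using raise_induction with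
  | h μ ih =>
    by_cases h : Dominated μ κ
    · rcases eq_or_ne μ κ with rfl | hne
      · rw [jackCoeff_self]; exact (lowerHookProduct_pos hα _).le
      · rw [jackCoeff_of_ne hne h]
        refine mul_nonneg (inv_nonneg.2 (sub_nonneg.2 (h.eigenvalue_lt hne hα).le)) ?_
        refine Finset.sum_nonneg fun i _ => Finset.sum_nonneg fun j hj =>
          Finset.sum_nonneg fun b hb => ?_
        rw [Finset.mem_Ioi] at hj
        rw [Finset.mem_range] at hb
        refine mul_nonneg ?_ (ih i j b hj hb)
        have h1 : (b : ℝ) ≤ μ.1 j := by exact_mod_cast hb.le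
        have h2 : (μ.1 j : ℝ) ≤ μ.1 i := by exact_mod_cast μ.2 hj.le
        linarith
    · rw [jackCoeff_of_not_dominated h]

/-- The polynomial with prescribed coefficients in degree `n`. -/
noncomputable def ofCoeff (n : ℕ) (c : (Fin m → ℕ) → ℝ) : MvPolynomial (Fin m) ℝ :=
  ∑ ν ∈ Finset.piAntidiag (Finset.univ : Finset (Fin m)) n,
    monomial (Finsupp.equivFunOnFinite.symm ν) (c ν)

theorem coeffAt_monomial (μ ν : Fin m → ℕ) (a : ℝ) :
    coeffAt μ (monomial (Finsupp.equivFunOnFinite.symm ν) a) = if ν = μ then a else 0 := by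
  simp [coeffAt, coeff_monomial]

theorem coeffAt_ofCoeff (n : ℕ) (c : (Fin m → ℕ) → ℝ) (μ : Fin m → ℕ) :
    coeffAt μ (ofCoeff n c) = if ∑ i, μ i = n then c μ else 0 := by
  rw [ofCoeff, coeffAt_sum]
  simp [coeffAt_monomial]

/-- The formula for `lbPoly` breaks the symmetry by choosing `i < j`, so symmetry is read off from
the values, where the sum runs over all ordered pairs. -/
theorem isSymmetric_lbPoly (α : ℝ) {f : MvPolynomial (Fin m) ℝ} (hf : f.IsSymmetric) :
    (lbPoly α f).IsSymmetric := by
  intro w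
  refine eq_of_eval_injective fun t ht => ?_
  rw [eval_rename, eval_lbPoly α hf ht, eval_lbPoly α hf (ht.comp w.injective)]
  have h1 : ∀ i, eval (t ∘ w) (pderiv i f) = eval t (pderiv (w i) f) := fun i => by
    rw [← eval_rename, rename_pderiv_of_isSymmetric hf]
  have h2 : ∀ i, eval (t ∘ w) (pderiv i (pderiv i f)) =
      eval t (pderiv (w i) (pderiv (w i) f)) := fun i => by
    rw [← eval_rename, rename_pderiv, rename_pderiv_of_isSymmetric hf]
  unfold laplaceBeltrami
  simp only [h1, h2, Function.comp_apply]
  congr 1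
  · rw [Equiv.sum_comp w fun i => t i ^ 2 * eval t (pderiv i (pderiv i f))]
  · rw [← Equiv.sum_comp w (fun i => ∑ j ∈ Finset.univ.erase i,
      t i ^ 2 / (t i - t j) * eval t (pderiv i f))]
    refine Finset.sum_congr rfl fun i _ => ?_
    refine Finset.sum_equiv w ?_ ?_ <;> simp

theorem coeffAt_ext_of_isSymmetric {f g : MvPolynomial (Fin m) ℝ} (hf : f.IsSymmetric)
    (hg : g.IsSymmetric) (h : ∀ μ : MultiIndex m, coeffAt μ.1 f = coeffAt μ.1 g) : f = g :=
  ext_coeffAt fun μ => by rw [← coeffAt_sorted hf, ← coeffAt_sorted hg, h]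

theorem coeffAt_lbPoly' (α : ℝ) {f : MvPolynomial (Fin m) ℝ} (hf : f.IsSymmetric)
    (μ : MultiIndex m) :
    coeffAt μ.1 (lbPoly α f) =
      eigenvalue α μ * coeffAt μ.1 f + raiseSum (fun ν => coeffAt ν.1 f) μ := by
  rw [coeffAt_lbPoly α hf, raiseSum]
  simp only [coeffAt_sorted hf]

theorem eigen_iff {α e : ℝ} {f : MvPolynomial (Fin m) ℝ} (hf : f.IsSymmetric) :
    (∀ t : Fin m → ℝ, Function.Injective t → laplaceBeltrami α f t = e * eval t f) ↔
      lbPoly α f = e • f := by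
  constructor
  · intro h
    refine eq_of_eval_injective fun t ht => ?_
    rw [eval_lbPoly α hf ht, h t ht, smul_eval]
  · intro h t ht
    rw [← eval_lbPoly α hf ht, h, smul_eval]

theorem isJack_ofCoeff {α : ℝ} (hα : 0 < α) (κ : MultiIndex m) :
    IsJack α κ (ofCoeff (degree κ) fun ν => jackCoeff α κ (sorted ν)) := by
  have hc : ∀ ν : Fin m → ℕ, coeffAt ν (ofCoeff (degree κ) fun ν => jackCoeff α κ (sorted ν)) =
      jackCoeff α κ (sorted ν) := by
    intro ν
    rw [coeffAt_ofCoeff]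
    split_ifs with h
    · rfl
    · rw [jackCoeff_of_not_dominated]
      intro h'
      exact h (by rw [← degree_sorted, h'.1])
  have hs : (ofCoeff (degree κ) fun ν => jackCoeff α κ (sorted ν)).IsSymmetric :=
    isSymmetric_of_coeffAt fun w μ => by rw [hc, hc, sorted_comp]
  refine ⟨hs, fun μ hμ => ?_, ?_, ?_⟩
  · rw [hc, sorted_self] at hμ
    by_contra h
    exact hμ (jackCoeff_of_not_dominated h)
  · rw [hc, sorted_self, jackCoeff_self]
  · rw [eigen_iff hs]
    refine coeffAt_ext_of_isSymmetric (isSymmetric_lbPoly α hs) (fun w => by rw [map_smul, hs w])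
      fun μ => ?_
    rw [coeffAt_lbPoly' α hs, coeffAt_smul]
    simp only [hc, sorted_self]
    exact jackCoeff_eigen hα κ μ

theorem IsJack.coeffAt_eq {α : ℝ} (hα : 0 < α) {κ : MultiIndex m} {J : MvPolynomial (Fin m) ℝ}
    (hJ : IsJack α κ J) (μ : MultiIndex m) : coeffAt μ.1 J = jackCoeff α κ μ := by
  induction μ using raise_induction with
  | h μ ih =>
    by_cases h : Dominated μ κ
    · rcases eq_or_ne μ κ with rfl | hne
      · rw [jackCoeff_self, hJ.leading]
      · have h1 := (eigen_iff hJ.symmetric).1 hJ.eigen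
        have h2 := coeffAt_lbPoly' α hJ.symmetric μ
        rw [h1, coeffAt_smul] at h2
        have h3 : raiseSum (fun ν => coeffAt ν.1 J) μ = raiseSum (jackCoeff α κ) μ := by
          refine Finset.sum_congr rfl fun i _ => Finset.sum_congr rfl fun j hj =>
            Finset.sum_congr rfl fun b hb => ?_
          simp only [ih i j b (Finset.mem_Ioi.1 hj) (Finset.mem_range.1 hb)]
        have := h.eigenvalue_lt hne hα
        have : eigenvalue α κ - eigenvalue α μ ≠ 0 := by linarith
        rw [jackCoeff_of_ne hne h, ← h3]
        field_simp
        linarith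
    · rw [jackCoeff_of_not_dominated h]
      by_contra h'
      exact h (hJ.triangular μ h')

theorem existsUnique_isJack {α : ℝ} (hα : 0 < α) (κ : MultiIndex m) :
    ∃! J : MvPolynomial (Fin m) ℝ, IsJack α κ J :=
  ⟨_, isJack_ofCoeff hα κ, fun _ hJ => coeffAt_ext_of_isSymmetric hJ.symmetric
    (isJack_ofCoeff hα κ).symmetric fun μ => by
      rw [hJ.coeffAt_eq hα, (isJack_ofCoeff hα κ).coeffAt_eq hα]⟩

theorem isJack_jack {α : ℝ} (hα : 0 < α) (κ : MultiIndex m) : IsJack α κ (jack α κ) := by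
  have h := (existsUnique_isJack hα κ).exists
  rw [jack, dif_pos h]
  exact h.choose_spec

theorem jack_eq_ofCoeff {α : ℝ} (hα : 0 < α) (κ : MultiIndex m) :
    jack α κ = ofCoeff (degree κ) fun ν => jackCoeff α κ (sorted ν) :=
  (existsUnique_isJack hα κ).unique (isJack_jack hα κ) (isJack_ofCoeff hα κ)

theorem coeffAt_jack {α : ℝ} (hα : 0 < α) (κ : MultiIndex m) (ν : Fin m → ℕ) :
    coeffAt ν (jack α κ) = jackCoeff α κ (sorted ν) := by
  rw [← coeffAt_sorted (isJack_jack hα κ).symmetric, (isJack_jack hα κ).coeffAt_eq hα]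

theorem eval_ofCoeff_one (n : ℕ) (c : (Fin m → ℕ) → ℝ) :
    eval (fun _ => 1) (ofCoeff n c) =
      ∑ ν ∈ Finset.piAntidiag (Finset.univ : Finset (Fin m)) n, c ν := by
  rw [ofCoeff, map_sum]
  simp [eval_monomial]

theorem jackAtOne_eq {α : ℝ} (hα : 0 < α) (κ : MultiIndex m) :
    jackAtOne α κ = ∑ ν ∈ Finset.piAntidiag (Finset.univ : Finset (Fin m)) (degree κ),
      jackCoeff α κ (sorted ν) := by
  rw [jackAtOne, jack_eq_ofCoeff hα, eval_ofCoeff_one]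

theorem jackAtOne_pos {α : ℝ} (hα : 0 < α) (κ : MultiIndex m) : 0 < jackAtOne α κ := by
  rw [jackAtOne_eq hα]
  refine Finset.sum_pos' (fun _ _ => jackCoeff_nonneg hα _ _) ⟨κ.1, ?_, ?_⟩
  · simp [degree]
  · rw [sorted_self, jackCoeff_self]
    exact lowerHookProduct_pos hα κ

theorem isHomogeneous_jack {α : ℝ} (hα : 0 < α) (κ : MultiIndex m) :
    (jack α κ).IsHomogeneous (degree κ) := by
  rw [jack_eq_ofCoeff hα]
  refine IsHomogeneous.sum _ _ _ fun ν hν => isHomogeneous_monomial _ ?_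
  rw [Finset.mem_piAntidiag] at hν
  rw [Finsupp.degree_eq_sum]
  simpa using hν.1

/-! ### Dunkl and Cherednik operators -/

/-- The Dunkl operator `α ∂ᵢ + ∑_{j ≠ i} (1 - sᵢⱼ) / (Xᵢ - Xⱼ)`. -/
noncomputable def dunkl (α : ℝ) (i : Fin m) :
    MvPolynomial (Fin m) ℝ →ₗ[ℝ] MvPolynomial (Fin m) ℝ :=
  α • (pderiv i).toLinearMap + ∑ j, divDiff i j

theorem dunkl_apply (α : ℝ) (i : Fin m) (f : MvPolynomial (Fin m) ℝ) :
    dunkl α i f = α • pderiv i f + ∑ j, divDiff i j f := by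
  simp [dunkl]

/-- The Cherednik operator `Xᵢ Tᵢ + ∑_{j > i} sᵢⱼ`, where `Tᵢ` is the Dunkl operator. -/
noncomputable def cherednik (α : ℝ) (i : Fin m) :
    MvPolynomial (Fin m) ℝ →ₗ[ℝ] MvPolynomial (Fin m) ℝ :=
  LinearMap.mulLeft ℝ (X i) ∘ₗ dunkl α i +
    ∑ j ∈ Finset.Ioi i, (rename (Equiv.swap i j)).toLinearMap

theorem cherednik_apply (α : ℝ) (i : Fin m) (f : MvPolynomial (Fin m) ℝ) :
    cherednik α i f = X i * dunkl α i f + ∑ j ∈ Finset.Ioi i, rename (Equiv.swap i j) f := by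
  simp [cherednik]

theorem rename_dunkl (w : Equiv.Perm (Fin m)) (α : ℝ) (i : Fin m) (f : MvPolynomial (Fin m) ℝ) :
    rename w (dunkl α i f) = dunkl α (w i) (rename w f) := by
  rw [dunkl_apply, dunkl_apply, map_add, map_smul, rename_pderiv, map_sum]
  simp only [rename_divDiff]
  rw [Equiv.sum_comp w fun j => divDiff (w i) j (rename w f)]

theorem divDiff_self (i : Fin m) : divDiff i i = 0 := by simp [divDiff]

theorem dunkl_X_mul_self (α : ℝ) (i : Fin m) (f : MvPolynomial (Fin m) ℝ) :
    dunkl α i (X i * f) = X i * dunkl α i f + α • f +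
      ∑ j ∈ Finset.univ.erase i, rename (Equiv.swap i j) f := by
  rw [dunkl_apply, dunkl_apply, ← Finset.add_sum_erase _ _ (Finset.mem_univ i), divDiff_self,
    ← Finset.add_sum_erase _ (fun j => divDiff i j f) (Finset.mem_univ i), divDiff_self,
    Finset.sum_congr rfl fun j hj => divDiff_X_mul_left (Finset.ne_of_mem_erase hj).symm f,
    Finset.sum_add_distrib, ← Finset.mul_sum, pderiv_mul, pderiv_X_self]
  simp only [LinearMap.zero_apply, zero_add, smul_add, one_mul, mul_add, mul_smul_comm]
  ring

theorem dunkl_X_mul_of_ne (α : ℝ) {i k : Fin m} (h : i ≠ k) (f : MvPolynomial (Fin m) ℝ) :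
    dunkl α i (X k * f) = X k * dunkl α i f - rename (Equiv.swap i k) f := by
  rw [dunkl_apply, dunkl_apply, ← Finset.add_sum_erase _ _ (Finset.mem_univ k),
    ← Finset.add_sum_erase _ (fun j => divDiff i j f) (Finset.mem_univ k),
    Finset.sum_congr rfl fun j hj => divDiff_X_mul_of_ne h.symm (Finset.ne_of_mem_erase hj).symm f,
    ← Finset.mul_sum, pderiv_mul, pderiv_X_of_ne h.symm, divDiff_X_mul_right h]
  simp only [zero_mul, zero_add, mul_add, mul_smul_comm]
  ring

theorem rename_mul_apply (v w : Equiv.Perm (Fin m)) (f : MvPolynomial (Fin m) ℝ) :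
    rename v (rename w f) = rename (v * w : Equiv.Perm (Fin m)) f := by
  rw [rename_rename]; rfl

theorem rename_perm_one (f : MvPolynomial (Fin m) ℝ) :
    rename (1 : Equiv.Perm (Fin m)) f = f := rename_id_apply f

theorem rename_rename_swap (w : Equiv.Perm (Fin m)) (i j : Fin m) (f : MvPolynomial (Fin m) ℝ) :
    rename w (rename (Equiv.swap i j) f) = rename (Equiv.swap (w i) (w j)) (rename w f) := by
  rw [rename_mul_apply, rename_mul_apply, Equiv.mul_swap_eq_swap_mul]

/-- The adjacent transposition of `i` and `i + 1`. -/
def adj (i : Fin n) : Equiv.Perm (Fin (n + 1)) := Equiv.swap i.castSucc i.succ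

theorem adj_castSucc (i : Fin n) : adj i i.castSucc = i.succ := Equiv.swap_apply_left _ _

theorem adj_succ (i : Fin n) : adj i i.succ = i.castSucc := Equiv.swap_apply_right _ _

theorem adj_of_ne {i : Fin n} {k : Fin (n + 1)} (h1 : k ≠ i.castSucc) (h2 : k ≠ i.succ) :
    adj i k = k := Equiv.swap_apply_of_ne_of_ne h1 h2

theorem adj_mul_self (i : Fin n) : adj i * adj i = 1 := Equiv.swap_mul_self _ _

theorem adj_adj (i : Fin n) (k : Fin (n + 1)) : adj i (adj i k) = k :=
  Equiv.swap_apply_self _ _ _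

theorem adj_comp_adj (i : Fin n) : ⇑(adj i) ∘ ⇑(adj i) = id := funext (adj_adj i)

theorem rename_adj_rename_adj (i : Fin n) (f : MvPolynomial (Fin (n + 1)) ℝ) :
    rename (adj i) (rename (adj i) f) = f := by
  rw [rename_mul_apply, adj_mul_self, rename_perm_one]

theorem sum_Ioi_eq {M : Type*} [AddCommMonoid M] (a : Fin m) (F : Fin m → M) :
    ∑ j ∈ Finset.Ioi a, F j = ∑ j, if a < j then F j else 0 := by
  rw [← Finset.sum_filter]
  refine Finset.sum_congr ?_ fun _ _ => rfl
  ext; simp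

/-- A relation of the degenerate affine Hecke algebra: `sᵢ Yᵢ = Yᵢ₊₁ sᵢ + 1`. The extra `1` is the
term `j = i + 1` of the tail of `Yᵢ`, since `sᵢ sᵢ = 1`. -/
theorem rename_adj_cherednik_castSucc (α : ℝ) (i : Fin n) (f : MvPolynomial (Fin (n + 1)) ℝ) :
    rename (adj i) (cherednik α i.castSucc f) = cherednik α i.succ (rename (adj i) f) + f := by
  have hI : Finset.Ioi i.castSucc = insert i.succ (Finset.Ioi i.succ) := by
    ext k
    simp only [Finset.mem_Ioi, Finset.mem_insert, Fin.lt_def, Fin.ext_iff, Fin.val_castSucc,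
      Fin.val_succ]
    omega
  rw [cherednik_apply, cherednik_apply, map_add, map_mul, rename_X, rename_dunkl, adj_castSucc,
    hI, Finset.sum_insert (by simp), map_add]
  have h1 : rename (adj i) (rename (Equiv.swap i.castSucc i.succ) f) = f :=
    rename_adj_rename_adj i f
  have h2 : ∀ j ∈ Finset.Ioi i.succ, rename (adj i) (rename (Equiv.swap i.castSucc j) f) =
      rename (Equiv.swap i.succ j) (rename (adj i) f) := fun j hj => by
    have hj := Finset.mem_Ioi.1 hj
    rw [rename_rename_swap, adj_castSucc, adj_of_ne (by rintro rfl; simp [Fin.lt_def] at hj)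
      hj.ne']
  rw [h1, map_sum, Finset.sum_congr rfl h2]
  ring

theorem rename_adj_cherednik_succ (α : ℝ) (i : Fin n) (f : MvPolynomial (Fin (n + 1)) ℝ) :
    rename (adj i) (cherednik α i.succ f) =
      cherednik α i.castSucc (rename (adj i) f) - f := by
  have := rename_adj_cherednik_castSucc α i (rename (adj i) f)
  rw [rename_adj_rename_adj] at this
  have := congrArg (rename (adj i)) this
  rw [rename_adj_rename_adj, map_add, rename_adj_rename_adj] at this
  rw [this]; ring

theorem rename_adj_cherednik_of_ne (α : ℝ) {i : Fin n} {k : Fin (n + 1)} (h1 : k ≠ i.castSucc)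
    (h2 : k ≠ i.succ) (f : MvPolynomial (Fin (n + 1)) ℝ) :
    rename (adj i) (cherednik α k f) = cherednik α k (rename (adj i) f) := by
  rw [cherednik_apply, cherednik_apply, map_add, map_mul, rename_X, rename_dunkl,
    adj_of_ne h1 h2, map_sum]
  congr 1
  refine Finset.sum_equiv (adj i) (fun j => ?_) fun j _ => by
    rw [rename_rename_swap, adj_of_ne h1 h2]
  simp only [Finset.mem_Ioi]
  rcases eq_or_ne j i.castSucc with rfl | hj1
  · rw [adj_castSucc]
    simp only [Fin.lt_def, Fin.ext_iff, Fin.val_castSucc, Fin.val_succ, ne_eq] at *; omega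
  rcases eq_or_ne j i.succ with rfl | hj2
  · rw [adj_succ]
    simp only [Fin.lt_def, Fin.ext_iff, Fin.val_castSucc, Fin.val_succ, ne_eq] at *; omega
  rw [adj_of_ne hj1 hj2]

/-- The cyclic permutation that sends `i + 1` to `i` and `0` to the last index. -/
def cyc (n : ℕ) : Equiv.Perm (Fin (n + 1)) := (finRotate (n + 1)).symm

theorem cyc_zero : cyc n 0 = Fin.last n := by
  rw [cyc, Equiv.symm_apply_eq, finRotate_last]

theorem cyc_succ (i : Fin n) : cyc n i.succ = i.castSucc := by
  rw [cyc, Equiv.symm_apply_eq]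
  ext
  rw [coe_finRotate_of_ne_last (Fin.castSucc_lt_last i).ne]
  simp

/-- The raising operator `f ↦ X_last * cyc f`. -/
noncomputable def phi (f : MvPolynomial (Fin (n + 1)) ℝ) : MvPolynomial (Fin (n + 1)) ℝ :=
  X (Fin.last n) * rename (cyc n) f

/-- Moving the Dunkl operator past the last variable produces a transposition with the last index,
which cancels the corresponding term in the tail of the Cherednik operator. -/
theorem cherednik_castSucc_phi (α : ℝ) (i : Fin n) (f : MvPolynomial (Fin (n + 1)) ℝ) :
    cherednik α i.castSucc (phi f) = phi (cherednik α i.succ f) := by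
  have hne : i.castSucc ≠ Fin.last n := (Fin.castSucc_lt_last i).ne
  unfold phi
  set g := rename (cyc n) f with hg
  rw [cherednik_apply, cherednik_apply, dunkl_X_mul_of_ne α hne, map_add, map_mul, rename_X,
    rename_dunkl, cyc_succ, ← hg, map_sum, sum_Ioi_eq, sum_Ioi_eq, Fin.sum_univ_castSucc,
    Fin.sum_univ_succ]
  have h1 : ∀ k : Fin n, (if i.castSucc < k.castSucc then
      rename (Equiv.swap i.castSucc k.castSucc) (X (Fin.last n) * g) else 0) =
      X (Fin.last n) * (if i < k then rename (Equiv.swap i.castSucc k.castSucc) g else 0) := by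
    intro k
    simp only [Fin.castSucc_lt_castSucc_iff]
    split_ifs
    · rw [map_mul, rename_X, Equiv.swap_apply_of_ne_of_ne hne.symm (Fin.castSucc_lt_last k).ne']
    · simp
  have h2 : ∀ k : Fin n, (if i.succ < k.succ then
      rename (cyc n) (rename (Equiv.swap i.succ k.succ) f) else 0) =
      (if i < k then rename (Equiv.swap i.castSucc k.castSucc) g else 0) := by
    intro k
    simp only [Fin.succ_lt_succ_iff, rename_rename_swap, cyc_succ, hg]
  simp only [h1, h2, ← Finset.mul_sum]
  rw [if_pos (Fin.castSucc_lt_last i), if_neg (by simp), map_mul, rename_X,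
    Equiv.swap_apply_right]
  ring

/-- The last operator has no tail, but moving `T_last` past `X_last` creates `α` and all
transpositions with the last index; the latter are the image under `cyc` of the tail of the operator
at `0`. -/
theorem cherednik_last_phi (α : ℝ) (f : MvPolynomial (Fin (n + 1)) ℝ) :
    cherednik α (Fin.last n) (phi f) = phi (cherednik α 0 f + α • f) := by
  unfold phi
  set g := rename (cyc n) f with hg
  rw [cherednik_apply, cherednik_apply, dunkl_X_mul_self, map_add, map_add, map_mul, rename_X,
    rename_dunkl, cyc_zero, ← hg, map_sum, map_smul, ← hg]
  have h1 : Finset.Ioi (Fin.last n) = ∅ := by ext; simp [Fin.le_last]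
  have h2 : ∑ j ∈ Finset.univ.erase (Fin.last n), rename (Equiv.swap (Fin.last n) j) g =
      ∑ k : Fin n, rename (Equiv.swap (Fin.last n) k.castSucc) g := by
    have := Finset.add_sum_erase Finset.univ
      (fun j => rename (Equiv.swap (Fin.last n) j) g) (Finset.mem_univ (Fin.last n))
    rw [Fin.sum_univ_castSucc] at this
    exact add_left_cancel (this.trans (add_comm _ _))
  have h3 : ∑ j ∈ Finset.Ioi (0 : Fin (n + 1)), rename (cyc n) (rename (Equiv.swap 0 j) f) =
      ∑ k : Fin n, rename (Equiv.swap (Fin.last n) k.castSucc) g := by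
    rw [sum_Ioi_eq, Fin.sum_univ_succ]
    simp only [rename_rename_swap, cyc_zero, cyc_succ, lt_irrefl, if_false, zero_add,
      Fin.succ_pos, if_true, hg]
  rw [h1, h2, h3, Finset.sum_empty]
  ring

/-! ### The joint spectrum of the Cherednik operators -/

/-- The strict total order on the positions of a composition: `j` lies below `i`. -/
def Below (η : Fin m → ℕ) (j i : Fin m) : Prop := η j < η i ∨ (i < j ∧ η j = η i)

instance (η : Fin m → ℕ) (j i : Fin m) : Decidable (Below η j i) :=
  inferInstanceAs (Decidable (_ ∨ _))

/-- The number of positions below `i`. -/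
def rank (η : Fin m → ℕ) (i : Fin m) : ℕ := (Finset.univ.filter fun j => Below η j i).card

/-- The eigenvalue of the `i`-th Cherednik operator that belongs to the composition `η`. -/
noncomputable def bar (α : ℝ) (η : Fin m → ℕ) (i : Fin m) : ℝ := α * η i + rank η i

theorem Below.trans {η : Fin m → ℕ} {i j k : Fin m} (h : Below η i j) (h' : Below η j k) :
    Below η i k := by
  unfold Below at *
  omega

theorem not_below_self (η : Fin m → ℕ) (i : Fin m) : ¬ Below η i i := by
  unfold Below; omega

theorem below_or_below (η : Fin m → ℕ) {i j : Fin m} (h : i ≠ j) :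
    Below η i j ∨ Below η j i := by
  unfold Below; omega

theorem Below.rank_lt {η : Fin m → ℕ} {i j : Fin m} (h : Below η j i) :
    rank η j < rank η i := by
  refine Finset.card_lt_card (Finset.ssubset_iff_of_subset ?_ |>.2 ⟨j, ?_, ?_⟩)
  · intro k hk
    simp only [Finset.mem_filter, Finset.mem_univ, true_and] at hk ⊢
    exact hk.trans h
  · simpa using h
  · simpa using not_below_self η j

theorem Below.bar_lt {η : Fin m → ℕ} {i j : Fin m} (h : Below η j i) {α : ℝ} (hα : 0 < α) :
    bar α η j < bar α η i := by
  have h1 : (rank η j : ℝ) < rank η i := by exact_mod_cast h.rank_lt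
  have h2 : (η j : ℝ) ≤ η i := by
    unfold Below at h
    exact_mod_cast (by omega : η j ≤ η i)
  have := mul_le_mul_of_nonneg_left h2 hα.le
  unfold bar
  linarith

theorem bar_lt_iff {α : ℝ} (hα : 0 < α) (η : Fin m → ℕ) {i j : Fin m} :
    bar α η j < bar α η i ↔ Below η j i := by
  refine ⟨fun h => ?_, fun h => h.bar_lt hα⟩
  rcases eq_or_ne i j with rfl | hij
  · exact absurd h (lt_irrefl _)
  · rcases below_or_below η hij with h' | h'
    · exact absurd h (h'.bar_lt hα).not_gt
    · exact h'

/-- The eigenvalues are ordered exactly as the positions are by `Below`, so they determine the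
ranks; subtracting the rank leaves `α * η i`. Hence the joint spectrum separates compositions. -/
theorem eq_comp_of_bar_eq_comp {α : ℝ} (hα : 0 < α) {η ζ : Fin m → ℕ} (w : Equiv.Perm (Fin m))
    (h : ∀ i, bar α ζ i = bar α η (w i)) : ζ = η ∘ w := by
  have hr : ∀ i, rank ζ i = rank η (w i) := by
    intro i
    refine Finset.card_equiv w fun j => ?_
    simp only [Finset.mem_filter, Finset.mem_univ, true_and]
    rw [← bar_lt_iff hα, ← bar_lt_iff hα, h, h]
  ext i
  have := h i
  rw [bar, bar, hr, add_left_inj] at this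
  exact_mod_cast mul_left_cancel₀ hα.ne' this

theorem eq_of_bar_eq {α : ℝ} (hα : 0 < α) {η ζ : Fin m → ℕ}
    (h : ∀ i, bar α ζ i = bar α η i) : ζ = η := eq_comp_of_bar_eq_comp hα 1 h

theorem bar_comp_adj (α : ℝ) {η : Fin (n + 1) → ℕ} {i : Fin n} (h : η i.castSucc ≠ η i.succ)
    (k : Fin (n + 1)) : bar α (η ∘ adj i) k = bar α η (adj i k) := by
  have hr : rank (η ∘ adj i) k = rank η (adj i k) := by
    refine Finset.card_equiv (adj i) fun j => ?_
    simp only [Finset.mem_filter, Finset.mem_univ, true_and]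
    simp only [Below, Function.comp_apply]
    refine or_congr_right (and_congr_left fun e => ?_)
    rcases eq_or_ne j i.castSucc with rfl | hj1
    · rcases eq_or_ne k i.castSucc with rfl | hk1
      · simp
      rcases eq_or_ne k i.succ with rfl | hk2
      · rw [adj_castSucc, adj_succ] at e; exact absurd e.symm h
      rw [adj_of_ne hk1 hk2, adj_castSucc]
      simp only [Fin.lt_def, Fin.ext_iff, Fin.val_castSucc, Fin.val_succ, ne_eq] at *; omega
    rcases eq_or_ne j i.succ with rfl | hj2
    · rcases eq_or_ne k i.castSucc with rfl | hk1
      · rw [adj_castSucc, adj_succ] at e; exact absurd e h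
      rcases eq_or_ne k i.succ with rfl | hk2
      · simp
      rw [adj_of_ne hk1 hk2, adj_succ]
      simp only [Fin.lt_def, Fin.ext_iff, Fin.val_castSucc, Fin.val_succ, ne_eq] at *; omega
    rw [adj_of_ne hj1 hj2]
    rcases eq_or_ne k i.castSucc with rfl | hk1
    · rw [adj_castSucc]
      simp only [Fin.lt_def, Fin.ext_iff, Fin.val_castSucc, Fin.val_succ, ne_eq] at *; omega
    rcases eq_or_ne k i.succ with rfl | hk2
    · rw [adj_succ]
      simp only [Fin.lt_def, Fin.ext_iff, Fin.val_castSucc, Fin.val_succ, ne_eq] at *; omega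
    rw [adj_of_ne hk1 hk2]
  rw [bar, bar, hr, Function.comp_apply]

/-- The ranks already differ by at least one in the direction of the entries, and `α` times the
difference of the entries adds strictly to this. This is where `α > 0` yields `|γ| < 1`. -/
theorem one_lt_abs_bar_sub {α : ℝ} (hα : 0 < α) {η : Fin m → ℕ} {i j : Fin m}
    (h : η i ≠ η j) : 1 < |bar α η j - bar α η i| := by
  wlog hlt : η i < η j generalizing i j
  · rw [abs_sub_comm]
    exact this h.symm (by omega)
  have h1 : (rank η i : ℝ) + 1 ≤ rank η j := by
    exact_mod_cast (show Below η i j from Or.inl hlt).rank_lt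
  have h2 : (η i : ℝ) < η j := by exact_mod_cast hlt
  have := mul_lt_mul_of_pos_left h2 hα
  refine lt_of_lt_of_le ?_ (le_abs_self _)
  unfold bar
  linarith

theorem bar_castSucc_of_eq (α : ℝ) {η : Fin (n + 1) → ℕ} {i : Fin n}
    (h : η i.castSucc = η i.succ) : bar α η i.castSucc = bar α η i.succ + 1 := by
  have : rank η i.castSucc = rank η i.succ + 1 := by
    have hI : (Finset.univ.filter fun j => Below η j i.castSucc) =
        insert i.succ (Finset.univ.filter fun j => Below η j i.succ) := by
      ext j
      simp only [Finset.mem_insert, Finset.mem_filter, Finset.mem_univ, true_and]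
      simp only [Below, h]
      rcases eq_or_ne j i.succ with rfl | hj
      · simp
      simp only [hj, false_or]
      refine or_congr_right (and_congr_left fun e => ?_)
      simp only [Fin.lt_def, Fin.ext_iff, Fin.val_castSucc, Fin.val_succ, ne_eq] at *; omega
    rw [rank, hI, Finset.card_insert_of_notMem (by simp [not_below_self]), rank]
  rw [bar, bar, this, h]
  push_cast; ring

/-- A zero in the last place is minimal for `Below`. This removes from the derivative exactly the
terms that are not in the image of `phi`. -/
theorem bar_last_of_eq_zero (α : ℝ) {η : Fin (n + 1) → ℕ} (h : η (Fin.last n) = 0) :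
    bar α η (Fin.last n) = 0 := by
  have : rank η (Fin.last n) = 0 := by
    rw [rank, Finset.card_eq_zero, Finset.filter_eq_empty_iff]
    intro j _
    simp only [Below, h, Nat.not_lt_zero, false_or, not_and]
    exact fun hj => absurd (Fin.le_last j) hj.not_ge
  rw [bar, this, h]
  simp

theorem bar_pos {α : ℝ} (hα : 0 < α) {η : Fin m → ℕ} {i : Fin m} (h : 0 < η i) :
    0 < bar α η i := by
  unfold bar
  have : (0 : ℝ) < η i := by exact_mod_cast h
  positivity

/-- The composition `(η₁, …, ηₙ, η₀ + 1)`. -/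
def phiIndex (η : Fin (n + 1) → ℕ) (k : Fin (n + 1)) : ℕ :=
  Fin.lastCases (motive := fun _ => ℕ) (η 0 + 1) (fun i => η i.succ) k

theorem phiIndex_last (η : Fin (n + 1) → ℕ) : phiIndex η (Fin.last n) = η 0 + 1 := by
  simp [phiIndex]

theorem phiIndex_castSucc (η : Fin (n + 1) → ℕ) (i : Fin n) :
    phiIndex η i.castSucc = η i.succ := by
  simp [phiIndex]

theorem sum_phiIndex (η : Fin (n + 1) → ℕ) : ∑ i, phiIndex η i = ∑ i, η i + 1 := by
  rw [Fin.sum_univ_castSucc, Fin.sum_univ_succ]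
  simp only [phiIndex_last, phiIndex_castSucc]
  ring

theorem bar_phiIndex_castSucc (α : ℝ) (η : Fin (n + 1) → ℕ) (i : Fin n) :
    bar α (phiIndex η) i.castSucc = bar α η i.succ := by
  have : rank (phiIndex η) i.castSucc = rank η i.succ := by
    rw [rank, rank, Finset.card_filter, Finset.card_filter, Fin.sum_univ_castSucc,
      Fin.sum_univ_succ, add_comm]
    simp only [Below, phiIndex_last, phiIndex_castSucc, Fin.castSucc_lt_castSucc_iff,
      Fin.succ_lt_succ_iff]
    congr 1
    refine if_congr ?_ rfl rfl
    simp only [Fin.castSucc_lt_last, true_and, Fin.not_lt_zero, false_and, or_false]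
    omega
  rw [bar, bar, this, phiIndex_castSucc]

theorem bar_phiIndex_last (α : ℝ) (η : Fin (n + 1) → ℕ) :
    bar α (phiIndex η) (Fin.last n) = bar α η 0 + α := by
  have : rank (phiIndex η) (Fin.last n) = rank η 0 := by
    rw [rank, rank, Finset.card_filter, Finset.card_filter, Fin.sum_univ_castSucc,
      Fin.sum_univ_succ, add_comm]
    simp only [Below, phiIndex_last, phiIndex_castSucc]
    congr 1
    · simp
    · refine Finset.sum_congr rfl fun k _ => if_congr ?_ rfl rfl
      have : ¬ Fin.last n < k.castSucc := by simp [Fin.le_last]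
      simp only [this, false_and, or_false, Fin.succ_pos, true_and]
      omega
  rw [bar, bar, this, phiIndex_last]
  push_cast; ring

/-- The inverse of `phiIndex` on compositions with a positive last entry. -/
def phiPred (η : Fin (n + 1) → ℕ) : Fin (n + 1) → ℕ :=
  Function.update (η ∘ cyc n) 0 (η (Fin.last n) - 1)

theorem phiIndex_phiPred {η : Fin (n + 1) → ℕ} (h : 0 < η (Fin.last n)) :
    phiIndex (phiPred η) = η := by
  ext k
  induction k using Fin.lastCases with
  | last => rw [phiIndex_last, phiPred, Function.update_self]; omega
  | cast i =>
    rw [phiIndex_castSucc, phiPred, Function.update_of_ne (Fin.succ_ne_zero i),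
      Function.comp_apply, cyc_succ]

/-! ### Nonsymmetric Jack polynomials -/

/-- `E` is the nonsymmetric Jack polynomial of `η`, normalized by `E(1, …, 1) = 1`. -/
structure IsNonsymJack (α : ℝ) (η : Fin m → ℕ) (E : MvPolynomial (Fin m) ℝ) : Prop where
  homogeneous : E.IsHomogeneous (∑ i, η i)
  eigen : ∀ i, cherednik α i E = bar α η i • E
  eval_one : eval (fun _ => 1) E = 1

theorem isNonsymJack_zero (α : ℝ) : IsNonsymJack α (0 : Fin m → ℕ) 1 := by
  refine ⟨by simpa using isHomogeneous_one (Fin m) ℝ, fun i => ?_, by simp⟩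
  rw [cherednik_apply, dunkl_apply]
  have h1 : ∀ j, divDiff i j (1 : MvPolynomial (Fin m) ℝ) = 0 := fun j =>
    divDiff_of_isSymmetric (fun w => map_one _) i j
  have h2 : rank (0 : Fin m → ℕ) i = (Finset.Ioi i).card := by
    rw [rank]
    congr 1
    ext; simp [Below]
  simp only [h1, pderiv_one, smul_zero, Finset.sum_const_zero, add_zero, mul_zero, zero_add,
    map_one, Finset.sum_const, bar, h2, Pi.zero_apply, Nat.cast_zero]
  rw [Nat.cast_smul_eq_nsmul]

theorem IsNonsymJack.phi {α : ℝ} {η : Fin (n + 1) → ℕ} {E : MvPolynomial (Fin (n + 1)) ℝ}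
    (h : IsNonsymJack α η E) : IsNonsymJack α (phiIndex η) (phi E) := by
  refine ⟨?_, fun k => ?_, ?_⟩
  · rw [sum_phiIndex, add_comm (∑ i, η i)]
    exact (isHomogeneous_X ℝ _).mul (h.homogeneous.rename_isHomogeneous)
  · induction k using Fin.lastCases with
    | last =>
      rw [cherednik_last_phi, h.eigen, bar_phiIndex_last, ← add_smul, JackBinomial.phi, map_smul,
        mul_smul_comm, JackBinomial.phi]
    | cast i =>
      rw [cherednik_castSucc_phi, h.eigen, bar_phiIndex_castSucc, JackBinomial.phi, map_smul,
        mul_smul_comm, JackBinomial.phi]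
  · rw [JackBinomial.phi, map_mul, eval_X, eval_rename, one_mul]
    exact h.eval_one

/-- The coefficient `1 / (η̄_{i+1} - η̄_i)` in the action of the adjacent transpositions. -/
noncomputable def gam (α : ℝ) (η : Fin (n + 1) → ℕ) (i : Fin n) : ℝ :=
  (bar α η i.succ - bar α η i.castSucc)⁻¹

theorem abs_gam_lt_one {α : ℝ} (hα : 0 < α) {η : Fin (n + 1) → ℕ} {i : Fin n}
    (h : η i.castSucc ≠ η i.succ) : |gam α η i| < 1 := by
  rw [gam, abs_inv]
  exact inv_lt_one_of_one_lt₀ (one_lt_abs_bar_sub hα h)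

theorem gam_comp_adj {α : ℝ} {η : Fin (n + 1) → ℕ} {i : Fin n}
    (h : η i.castSucc ≠ η i.succ) : gam α (η ∘ adj i) i = - gam α η i := by
  rw [gam, gam, bar_comp_adj α h, bar_comp_adj α h, adj_castSucc, adj_succ, ← inv_neg, neg_sub]

/-- The intertwiner of an adjacent transposition permutes the joint eigenvalues. -/
theorem cherednik_intertwiner {α : ℝ} {x : Fin (n + 1) → ℝ} {i : Fin n} {γ : ℝ}
    (hγ : γ * (x i.succ - x i.castSucc) = 1) {E : MvPolynomial (Fin (n + 1)) ℝ}
    (h : ∀ k, cherednik α k E = x k • E) (k : Fin (n + 1)) :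
    cherednik α k (rename (adj i) E + γ • E) = x (adj i k) • (rename (adj i) E + γ • E) := by
  rw [map_add, map_smul, h]
  rcases eq_or_ne k i.castSucc with rfl | h1
  · have := rename_adj_cherednik_succ α i E
    rw [h, map_smul, eq_sub_iff_add_eq] at this
    rw [← this, adj_castSucc, smul_add, smul_smul, smul_smul, add_assoc]
    congr 1
    nth_rewrite 1 [← one_smul ℝ E]
    rw [← add_smul]
    congr 1
    linarith
  rcases eq_or_ne k i.succ with rfl | h2
  · have := rename_adj_cherednik_castSucc α i E
    rw [h, map_smul, ← sub_eq_iff_eq_add] at this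
    rw [← this, adj_succ, smul_add, smul_smul, smul_smul, sub_add]
    rw [sub_eq_add_neg]
    congr 1
    nth_rewrite 1 [← one_smul ℝ E]
    rw [← sub_smul, ← neg_smul]
    congr 1
    linarith
  · rw [← rename_adj_cherednik_of_ne α h1 h2, h, adj_of_ne h1 h2, map_smul, smul_add, smul_smul,
      smul_smul, mul_comm γ]

theorem gam_mul {α : ℝ} (hα : 0 < α) {η : Fin (n + 1) → ℕ} {i : Fin n}
    (h : η i.castSucc ≠ η i.succ) :
    gam α η i * (bar α η i.succ - bar α η i.castSucc) = 1 := by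
  refine inv_mul_cancel₀ fun e => ?_
  have := one_lt_abs_bar_sub hα h
  rw [e, abs_zero] at this
  linarith

/-- The intertwined polynomial takes the value `1 + γ` at `(1, …, 1)`, which is nonzero because `|γ|
< 1`; this explains the normalizing factor. -/
theorem IsNonsymJack.adj {α : ℝ} (hα : 0 < α) {η : Fin (n + 1) → ℕ} {i : Fin n}
    (hne : η i.castSucc ≠ η i.succ) {E : MvPolynomial (Fin (n + 1)) ℝ}
    (h : IsNonsymJack α η E) : IsNonsymJack α (η ∘ adj i)
      ((1 + gam α η i)⁻¹ • (rename (adj i) E + gam α η i • E)) := by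
  have hγ : 1 + gam α η i ≠ 0 := by
    have := (abs_lt.1 (abs_gam_lt_one hα hne)).1
    linarith
  refine ⟨?_, fun k => ?_, ?_⟩
  · have : ∑ k, (η ∘ JackBinomial.adj i) k = ∑ k, η k := Equiv.sum_comp (JackBinomial.adj i) η
    rw [this]
    have h1 := h.homogeneous
    rw [← mem_homogeneousSubmodule] at h1 ⊢
    refine Submodule.smul_mem _ _ (Submodule.add_mem _ ?_ (Submodule.smul_mem _ _ h1))
    exact h.homogeneous.rename_isHomogeneous
  · rw [map_smul, cherednik_intertwiner (gam_mul hα hne) h.eigen, bar_comp_adj α hne, smul_comm]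
  · rw [smul_eval, map_add, smul_eval, eval_rename]
    have : eval ((fun _ => 1) ∘ JackBinomial.adj i) E = 1 := h.eval_one
    rw [this, h.eval_one, mul_one, inv_mul_cancel₀ hγ]

/-- Induction on the degree, and inside it on the place of a positive entry. In the last place it is
stripped off by `phi`; elsewhere an intertwiner moves it one step to the right. -/
theorem exists_isNonsymJack {α : ℝ} (hα : 0 < α) (η : Fin (n + 1) → ℕ) :
    ∃ E, IsNonsymJack α η E := by
  induction hd : ∑ i, η i using Nat.strong_induction_on generalizing η with
  | _ d ih =>
    by_cases h0 : η = 0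
    · exact ⟨1, h0 ▸ isNonsymJack_zero α⟩
    obtain ⟨k, hk⟩ := Function.ne_iff.1 h0
    replace hk : 0 < η k := Nat.pos_of_ne_zero hk
    clear h0
    induction k using Fin.reverseInduction generalizing η with
    | last =>
      obtain ⟨ζ, rfl⟩ : ∃ ζ, phiIndex ζ = η := ⟨_, phiIndex_phiPred hk⟩
      rw [sum_phiIndex] at hd
      obtain ⟨E, hE⟩ := ih (∑ i, ζ i) (by omega) ζ rfl
      exact ⟨_, hE.phi⟩
    | cast i ihk =>
      by_cases hs : 0 < η i.succ
      · exact ihk η hd hs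
      · obtain ⟨E, hE⟩ := ihk (η ∘ adj i) ((Equiv.sum_comp (adj i) η).trans hd) (by
          rwa [Function.comp_apply, adj_succ])
        have := hE.adj hα (i := i) (by
          rw [Function.comp_apply, Function.comp_apply, adj_succ, adj_castSucc]; omega)
        rw [Function.comp_assoc, adj_comp_adj, Function.comp_id] at this
        exact ⟨_, this⟩

theorem perm_induction {P : Equiv.Perm (Fin (n + 1)) → Prop} (one : P 1)
    (mul : ∀ v w, P v → P w → P (v * w)) (adj : ∀ i, P (adj i)) (w) : P w := by
  have hw : w ∈ Submonoid.closure (Set.range fun i : Fin n => Equiv.swap i.castSucc i.succ) := by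
    rw [Equiv.Perm.mclosure_swap_castSucc_succ]; trivial
  induction hw using Submonoid.closure_induction with
  | mem x hx => obtain ⟨i, rfl⟩ := hx; exact adj i
  | one => exact one
  | mul x y _ _ hx hy => exact mul x y hx hy

open Classical in
/-- The nonsymmetric Jack polynomial of a composition. -/
noncomputable def nonsymJack (α : ℝ) (η : Fin m → ℕ) : MvPolynomial (Fin m) ℝ :=
  if h : ∃ E, IsNonsymJack α η E then h.choose else 0

theorem isNonsymJack_nonsymJack {α : ℝ} (hα : 0 < α) (η : Fin (n + 1) → ℕ) :
    IsNonsymJack α η (nonsymJack α η) := by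
  have h := exists_isNonsymJack hα η
  rw [nonsymJack, dif_pos h]
  exact h.choose_spec

/-- Joint eigenvectors with distinct joint eigenvalues: the operator `Yᵢ - η̄ᵢ` removes `E_η` from a
relation and scales `E_ζ` by a nonzero factor once `i` is chosen to separate `ζ` from `η`. -/
theorem linearIndependent_nonsymJack {α : ℝ} (hα : 0 < α) :
    LinearIndependent ℝ (nonsymJack α : (Fin (n + 1) → ℕ) → MvPolynomial (Fin (n + 1)) ℝ) := by
  classical
  rw [linearIndependent_iff']
  intro s
  induction s using Finset.induction_on with
  | empty => simp
  | insert η s hη ih =>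
    intro c hc
    have hs : ∀ ζ ∈ s, c ζ = 0 := by
      intro ζ hζ
      have hne : ¬ ∀ i, bar α ζ i = bar α η i := fun h => hη (eq_of_bar_eq hα h ▸ hζ)
      push Not at hne
      obtain ⟨i, hi⟩ := hne
      have h1 := congrArg (fun f => cherednik α i f - bar α η i • f) hc
      simp only [map_sum, map_smul, (isNonsymJack_nonsymJack hα _).eigen, Finset.smul_sum,
        ← Finset.sum_sub_distrib, map_zero, smul_zero, sub_zero] at h1
      rw [Finset.sum_insert hη, smul_comm, sub_self, zero_add] at h1
      have h2 := ih (fun ζ => c ζ * (bar α ζ i - bar α η i)) (by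
        rw [← h1]
        refine Finset.sum_congr rfl fun ζ _ => ?_
        rw [smul_comm (bar α η i), ← smul_sub, ← sub_smul, smul_smul]) ζ hζ
      exact (mul_eq_zero.1 h2).resolve_right (sub_ne_zero.2 hi)
    rw [Finset.sum_insert hη, Finset.sum_eq_zero fun ζ hζ => by rw [hs ζ hζ, zero_smul],
      add_zero, smul_eq_zero] at hc
    have h0 : nonsymJack α η ≠ 0 := fun h => by
      have := (isNonsymJack_nonsymJack hα η).eval_one
      rw [h, map_zero] at this
      exact zero_ne_one this
    intro ζ hζ
    rcases Finset.mem_insert.1 hζ with rfl | hζ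
    · exact hc.resolve_right h0
    · exact hs ζ hζ

/-- The monomial `X ^ ν`. -/
noncomputable def mono (ν : Fin m → ℕ) : MvPolynomial (Fin m) ℝ :=
  monomial (Finsupp.equivFunOnFinite.symm ν) 1

theorem linearIndependent_mono :
    LinearIndependent ℝ (mono : (Fin m → ℕ) → MvPolynomial (Fin m) ℝ) := by
  have h := (basisMonomials (Fin m) ℝ).linearIndependent.comp
    (Finsupp.equivFunOnFinite.symm : (Fin m → ℕ) → (Fin m →₀ ℕ)) (Equiv.injective _)
  rw [coe_basisMonomials] at h
  exact h

theorem ofCoeff_eq_sum_mono (d : ℕ) (c : (Fin m → ℕ) → ℝ) :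
    ofCoeff d c = ∑ ν ∈ Finset.piAntidiag (Finset.univ : Finset (Fin m)) d, c ν • mono ν := by
  simp [ofCoeff, mono, smul_monomial]

theorem eq_ofCoeff_of_isHomogeneous {f : MvPolynomial (Fin m) ℝ} {d : ℕ}
    (hf : f.IsHomogeneous d) : f = ofCoeff d fun ν => coeffAt ν f := by
  refine ext_coeffAt fun μ => ?_
  rw [coeffAt_ofCoeff]
  split_ifs with h
  · rfl
  · refine hf.coeff_eq_zero ?_
    rw [Finsupp.degree_eq_sum]
    simpa using h

/-- Dimension count in each degree: the polynomials `E_η` are homogeneous, independent, and as many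
as the monomials. -/
theorem span_nonsymJack_image {α : ℝ} (hα : 0 < α) (d : ℕ) :
    Submodule.span ℝ (nonsymJack α '' {η : Fin (n + 1) → ℕ | ∑ i, η i = d}) =
      Submodule.span ℝ (mono '' {η : Fin (n + 1) → ℕ | ∑ i, η i = d}) := by
  classical
  have hset : {η : Fin (n + 1) → ℕ | ∑ i, η i = d} =
      (Finset.piAntidiag (Finset.univ : Finset (Fin (n + 1))) d : Set (Fin (n + 1) → ℕ)) := by
    ext; simp
  have hcard : ∀ f : (Fin (n + 1) → ℕ) → MvPolynomial (Fin (n + 1)) ℝ, LinearIndependent ℝ f →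
      Module.finrank ℝ (Submodule.span ℝ (f '' {η | ∑ i, η i = d})) =
        (Finset.piAntidiag (Finset.univ : Finset (Fin (n + 1))) d).card := by
    intro f hf
    have hinj : Function.Injective f := hf.injective
    rw [hset, ← Finset.coe_image, finrank_span_finset_eq_card, Finset.card_image_of_injective _ hinj]
    have := hf.linearIndepOn_id.mono (Set.image_subset_range f
      (Finset.piAntidiag (Finset.univ : Finset (Fin (n + 1))) d : Set (Fin (n + 1) → ℕ)))
    rwa [← Finset.coe_image] at this
  have hfin : ((mono : (Fin (n + 1) → ℕ) → _) '' {η | ∑ i, η i = d}).Finite := by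
    rw [hset]; exact (Finset.finite_toSet _).image _
  have : FiniteDimensional ℝ (Submodule.span ℝ
      ((mono : (Fin (n + 1) → ℕ) → MvPolynomial (Fin (n + 1)) ℝ) '' {η | ∑ i, η i = d})) :=
    FiniteDimensional.span_of_finite ℝ hfin
  refine Submodule.eq_of_le_of_finrank_eq ?_ ?_
  · rw [Submodule.span_le]
    rintro _ ⟨η, hη, rfl⟩
    have hh := (isNonsymJack_nonsymJack hα η).homogeneous
    rw [show ∑ i, η i = d from hη] at hh
    rw [eq_ofCoeff_of_isHomogeneous hh, ofCoeff_eq_sum_mono]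
    refine Submodule.sum_mem _ fun ν hν => Submodule.smul_mem _ _ (Submodule.subset_span ⟨ν, ?_, rfl⟩)
    simpa using hν
  · rw [hcard _ (linearIndependent_nonsymJack hα), hcard _ linearIndependent_mono]

theorem span_nonsymJack {α : ℝ} (hα : 0 < α) :
    ⊤ ≤ Submodule.span ℝ (Set.range
      (nonsymJack α : (Fin (n + 1) → ℕ) → MvPolynomial (Fin (n + 1)) ℝ)) := by
  intro f _
  induction f using MvPolynomial.induction_on' with
  | monomial u a =>
    have h1 : monomial u a = a • mono (Finsupp.equivFunOnFinite u) := by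
      simp [mono, smul_monomial]
    rw [h1]
    refine Submodule.smul_mem _ _ (Submodule.span_mono (Set.image_subset_range _
      {η | ∑ i, η i = ∑ i, u i}) ?_)
    rw [span_nonsymJack_image hα]
    exact Submodule.subset_span ⟨_, rfl, rfl⟩
  | add p q hp hq => exact Submodule.add_mem _ (hp trivial) (hq trivial)

/-- The basis of the nonsymmetric Jack polynomials. -/
noncomputable def nonsymBasis {α : ℝ} (hα : 0 < α) :
    Module.Basis (Fin (n + 1) → ℕ) ℝ (MvPolynomial (Fin (n + 1)) ℝ) :=
  Module.Basis.mk (linearIndependent_nonsymJack hα) (span_nonsymJack hα)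

theorem nonsymBasis_apply {α : ℝ} (hα : 0 < α) (η : Fin (n + 1) → ℕ) :
    nonsymBasis hα η = nonsymJack α η := by simp [nonsymBasis]

theorem repr_nonsymJack {α : ℝ} (hα : 0 < α) (η ζ : Fin (n + 1) → ℕ) :
    (nonsymBasis hα).repr (nonsymJack α η) ζ = if η = ζ then 1 else 0 := by
  classical
  rw [← nonsymBasis_apply hα, Module.Basis.repr_self, Finsupp.single_apply]

theorem repr_cherednik {α : ℝ} (hα : 0 < α) (i : Fin (n + 1)) (f : MvPolynomial (Fin (n + 1)) ℝ)
    (η : Fin (n + 1) → ℕ) : (nonsymBasis hα).repr (cherednik α i f) η =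
      bar α η i * (nonsymBasis hα).repr f η := by
  have : (nonsymBasis hα).coord η ∘ₗ cherednik α i = bar α η i • (nonsymBasis hα).coord η := by
    refine (nonsymBasis hα).ext fun ζ => ?_
    rw [LinearMap.comp_apply, nonsymBasis_apply, (isNonsymJack_nonsymJack hα ζ).eigen, map_smul,
      LinearMap.smul_apply, Module.Basis.coord_apply, repr_nonsymJack, smul_eq_mul, smul_eq_mul]
    split_ifs with h
    · rw [h]
    · simp
  exact congrArg (fun φ => φ f) this

theorem bar_eq_of_repr_ne_zero {α : ℝ} (hα : 0 < α) {f : MvPolynomial (Fin (n + 1)) ℝ}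
    {x : Fin (n + 1) → ℝ} (h : ∀ i, cherednik α i f = x i • f) {η : Fin (n + 1) → ℕ}
    (hη : (nonsymBasis hα).repr f η ≠ 0) (i : Fin (n + 1)) : bar α η i = x i := by
  have := repr_cherednik hα i f η
  rw [h, map_smul, Finsupp.smul_apply, smul_eq_mul] at this
  exact (mul_right_cancel₀ hη this).symm

theorem eq_smul_nonsymJack {α : ℝ} (hα : 0 < α) {f : MvPolynomial (Fin (n + 1)) ℝ}
    {η : Fin (n + 1) → ℕ} (h : ∀ i, cherednik α i f = bar α η i • f) :
    f = eval (fun _ => 1) f • nonsymJack α η := by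
  have h1 : f = (nonsymBasis hα).repr f η • nonsymJack α η := by
    apply (nonsymBasis hα).repr.injective
    ext ζ
    rw [map_smul, Finsupp.smul_apply, repr_nonsymJack, smul_eq_mul]
    split_ifs with e
    · rw [e, mul_one]
    · rw [mul_zero]
      by_contra hne
      exact e (eq_of_bar_eq hα (bar_eq_of_repr_ne_zero hα h hne)).symm
  have h2 := congrArg (eval fun _ => 1) h1
  rw [smul_eval, (isNonsymJack_nonsymJack hα η).eval_one, mul_one] at h2
  rw [h2]
  exact h1

theorem IsNonsymJack.eq {α : ℝ} (hα : 0 < α) {f : MvPolynomial (Fin (n + 1)) ℝ}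
    {η : Fin (n + 1) → ℕ} (h : IsNonsymJack α η f) : f = nonsymJack α η := by
  rw [eq_smul_nonsymJack hα h.eigen, h.eval_one, one_smul]

theorem phi_nonsymJack {α : ℝ} (hα : 0 < α) (η : Fin (n + 1) → ℕ) :
    phi (nonsymJack α η) = nonsymJack α (phiIndex η) :=
  (isNonsymJack_nonsymJack hα η).phi.eq hα

theorem rename_adj_nonsymJack_of_ne {α : ℝ} (hα : 0 < α) {η : Fin (n + 1) → ℕ} {i : Fin n}
    (h : η i.castSucc ≠ η i.succ) : rename (adj i) (nonsymJack α η) =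
      (1 + gam α η i) • nonsymJack α (η ∘ adj i) - gam α η i • nonsymJack α η := by
  have hγ : 1 + gam α η i ≠ 0 := by
    have := (abs_lt.1 (abs_gam_lt_one hα h)).1
    linarith
  rw [← ((isNonsymJack_nonsymJack hα η).adj hα h).eq hα, smul_smul, mul_inv_cancel₀ hγ, one_smul]
  abel

/-- Here the two eigenvalues differ by one, so `γ = -1` and the intertwiner gives `sᵢ E - E`. A
nonzero result would have the eigenvalues of `η` with two unequal ones exchanged, which belong to no
composition; hence it vanishes. -/
theorem rename_adj_nonsymJack_of_eq {α : ℝ} (hα : 0 < α) {η : Fin (n + 1) → ℕ} {i : Fin n}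
    (h : η i.castSucc = η i.succ) : rename (adj i) (nonsymJack α η) = nonsymJack α η := by
  have hb := bar_castSucc_of_eq α h
  have h1 := cherednik_intertwiner (γ := -1) (i := i) (x := bar α η) (by rw [hb]; ring)
    (isNonsymJack_nonsymJack hα η).eigen
  have h2 : rename (adj i) (nonsymJack α η) + (-1 : ℝ) • nonsymJack α η = 0 := by
    apply (nonsymBasis hα).repr.injective
    ext ζ
    rw [map_zero, Finsupp.zero_apply]
    by_contra hne
    have h3 := bar_eq_of_repr_ne_zero hα h1 hne
    have h4 : ζ = η := by
      rw [eq_comp_of_bar_eq_comp hα (adj i) h3]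
      ext k
      rw [Function.comp_apply]
      rcases eq_or_ne k i.castSucc with rfl | hk1
      · rw [adj_castSucc, h]
      rcases eq_or_ne k i.succ with rfl | hk2
      · rw [adj_succ, h]
      rw [adj_of_ne hk1 hk2]
    have h5 := h3 i.castSucc
    rw [h4, adj_castSucc] at h5
    linarith
  rw [neg_smul, one_smul, ← sub_eq_add_neg, sub_eq_zero] at h2
  exact h2

/-- The transpose of the action of `sᵢ` on the basis: only `E_η` and `E_{η ∘ sᵢ}` contribute to the
coordinate at `η ∘ sᵢ`, and `γ` changes sign between the two. -/
theorem repr_rename_adj {α : ℝ} (hα : 0 < α) (f : MvPolynomial (Fin (n + 1)) ℝ)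
    {η : Fin (n + 1) → ℕ} {i : Fin n} (h : η i.castSucc ≠ η i.succ) :
    (nonsymBasis hα).repr (rename (adj i) f) (η ∘ adj i) =
      (1 + gam α η i) * (nonsymBasis hα).repr f η +
        gam α η i * (nonsymBasis hα).repr f (η ∘ adj i) := by
  have hinj : ∀ ζ, ζ ∘ adj i = η ∘ adj i ↔ ζ = η := fun ζ =>
    (adj i).surjective.injective_comp_right.eq_iff
  have hne : η ∘ adj i ≠ η := fun e => h (by
    have := congrFun e i.castSucc
    rw [Function.comp_apply, adj_castSucc] at this
    exact this.symm)
  have : (nonsymBasis hα).coord (η ∘ adj i) ∘ₗ (rename (adj i)).toLinearMap =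
      (1 + gam α η i) • (nonsymBasis hα).coord η +
        gam α η i • (nonsymBasis hα).coord (η ∘ adj i) := by
    refine (nonsymBasis hα).ext fun ζ => ?_
    simp only [LinearMap.comp_apply, LinearMap.add_apply, LinearMap.smul_apply,
      Module.Basis.coord_apply, AlgHom.toLinearMap_apply, smul_eq_mul, nonsymBasis_apply]
    by_cases hζ : ζ i.castSucc = ζ i.succ
    · have h1 : ζ ≠ η := by rintro rfl; exact h hζ
      have h2 : ζ ≠ η ∘ adj i := by
        rintro rfl
        rw [Function.comp_apply, Function.comp_apply, adj_succ, adj_castSucc] at hζ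
        exact h hζ.symm
      rw [rename_adj_nonsymJack_of_eq hα hζ, repr_nonsymJack, repr_nonsymJack, if_neg h1, if_neg h2]
      simp
    · rw [rename_adj_nonsymJack_of_ne hα hζ, map_sub, map_smul, map_smul, Finsupp.sub_apply,
        Finsupp.smul_apply, Finsupp.smul_apply]
      simp only [repr_nonsymJack, hinj, smul_eq_mul]
      by_cases h1 : ζ = η
      · subst h1
        simp [hne.symm]
      · by_cases h2 : ζ = η ∘ adj i
        · subst h2
          rw [gam_comp_adj h]
          simp [hne]
        · simp [h1, h2]
  exact congrArg (fun φ => φ f) this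

theorem repr_adj_of_isSymmetric {α : ℝ} (hα : 0 < α) {f : MvPolynomial (Fin (n + 1)) ℝ}
    (hf : f.IsSymmetric) {η : Fin (n + 1) → ℕ} {i : Fin n} (h : η i.castSucc ≠ η i.succ) :
    (1 - gam α η i) * (nonsymBasis hα).repr f (η ∘ adj i) =
      (1 + gam α η i) * (nonsymBasis hα).repr f η := by
  have := repr_rename_adj hα f h
  rw [hf] at this
  linarith

/-- Along an orbit, the coordinates of a symmetric polynomial differ by positive factors. -/
theorem exists_repr_comp_eq {α : ℝ} (hα : 0 < α) (w : Equiv.Perm (Fin (n + 1)))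
    (η : Fin (n + 1) → ℕ) : ∃ r : ℝ, 0 < r ∧ ∀ f : MvPolynomial (Fin (n + 1)) ℝ, f.IsSymmetric →
      (nonsymBasis hα).repr f (η ∘ w) = r * (nonsymBasis hα).repr f η := by
  induction w using perm_induction generalizing η with
  | one => exact ⟨1, one_pos, fun f _ => by rw [one_mul]; rfl⟩
  | mul v w hv hw =>
    obtain ⟨r, hr, h⟩ := hv η
    obtain ⟨r', hr', h'⟩ := hw (η ∘ v)
    refine ⟨r' * r, mul_pos hr' hr, fun f hf => ?_⟩
    rw [mul_assoc, ← h f hf, ← h' f hf]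
    rfl
  | adj i =>
    by_cases hne : η i.castSucc = η i.succ
    · refine ⟨1, one_pos, fun f _ => ?_⟩
      have : η ∘ adj i = η := by
        ext k
        rw [Function.comp_apply]
        rcases eq_or_ne k i.castSucc with rfl | hk1
        · rw [adj_castSucc, hne]
        rcases eq_or_ne k i.succ with rfl | hk2
        · rw [adj_succ, hne]
        rw [adj_of_ne hk1 hk2]
      rw [this, one_mul]
    -- Invariance under `sᵢ` fixes the ratio of the two coordinates as `(1 + γ) / (1 - γ)`, which is
    -- positive since `|γ| < 1`.
    · have hγ := abs_lt.1 (abs_gam_lt_one hα hne)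
      have h1 : 0 < 1 - gam α η i := by linarith
      refine ⟨(1 + gam α η i) / (1 - gam α η i), div_pos (by linarith) h1, fun f hf => ?_⟩
      rw [div_mul_eq_mul_div, ← repr_adj_of_isSymmetric hα hf hne]
      field_simp

/-- The span of the nonsymmetric Jack polynomials whose orbit satisfies `S`. -/
def orbitSpan {α : ℝ} (hα : 0 < α) (S : MultiIndex (n + 1) → Prop) :
    Submodule ℝ (MvPolynomial (Fin (n + 1)) ℝ) where
  carrier := {f | ∀ η, ¬ S (sorted η) → (nonsymBasis hα).repr f η = 0}
  zero_mem' := fun η _ => by simp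
  add_mem' := fun {f g} hf hg η h => by
    rw [map_add, Finsupp.add_apply, hf η h, hg η h, add_zero]
  smul_mem' := fun c f hf η h => by
    rw [map_smul, Finsupp.smul_apply, hf η h, smul_zero]

theorem nonsymJack_mem_orbitSpan {α : ℝ} (hα : 0 < α) {S : MultiIndex (n + 1) → Prop}
    {η : Fin (n + 1) → ℕ} (h : S (sorted η)) : nonsymJack α η ∈ orbitSpan hα S := by
  intro ζ hζ
  rw [repr_nonsymJack, if_neg]
  rintro rfl
  exact hζ h

theorem orbitSpan_mono {α : ℝ} (hα : 0 < α) {S S' : MultiIndex (n + 1) → Prop}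
    (h : ∀ κ, S κ → S' κ) : orbitSpan hα S ≤ orbitSpan hα S' :=
  fun _ hf η hη => hf η fun h' => hη (h _ h')

theorem rename_mem_orbitSpan {α : ℝ} {hα : 0 < α} {S : MultiIndex (n + 1) → Prop}
    (w : Equiv.Perm (Fin (n + 1))) {f : MvPolynomial (Fin (n + 1)) ℝ}
    (hf : f ∈ orbitSpan hα S) : rename w f ∈ orbitSpan hα S := by
  induction w using perm_induction generalizing f with
  | one => rwa [rename_perm_one]
  | mul v w hv hw =>
    rw [← rename_mul_apply]
    exact hv (hw hf)
  | adj i =>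
    rw [← (nonsymBasis hα).linearCombination_repr f, Finsupp.linearCombination_apply,
      Finsupp.sum, map_sum]
    refine Submodule.sum_mem _ fun η hη => ?_
    rw [map_smul, nonsymBasis_apply]
    refine Submodule.smul_mem _ _ ?_
    have hS : S (sorted η) := by
      by_contra h
      exact Finsupp.mem_support_iff.1 hη (hf η h)
    by_cases h : η i.castSucc = η i.succ
    · rw [rename_adj_nonsymJack_of_eq hα h]
      exact nonsymJack_mem_orbitSpan hα hS
    · rw [rename_adj_nonsymJack_of_ne hα h]
      exact Submodule.sub_mem _
        (Submodule.smul_mem _ _ (nonsymJack_mem_orbitSpan hα (by rwa [sorted_comp])))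
        (Submodule.smul_mem _ _ (nonsymJack_mem_orbitSpan hα hS))

/-! ### Jack polynomials in terms of nonsymmetric Jack polynomials -/

theorem coeffAt_mono (μ ν : Fin m → ℕ) : coeffAt μ (mono ν) = if ν = μ then 1 else 0 :=
  coeffAt_monomial μ ν 1

theorem rename_mono (w : Equiv.Perm (Fin m)) (ν : Fin m → ℕ) :
    rename w (mono (ν ∘ w)) = mono ν := by
  refine ext_coeffAt fun μ => ?_
  rw [coeffAt_rename, coeffAt_mono, coeffAt_mono]
  refine if_congr ?_ rfl rfl
  exact w.surjective.injective_comp_right.eq_iff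

theorem X_mul_mono_update (ν : Fin m → ℕ) (i : Fin m) (p : ℕ) :
    X i * mono (Function.update ν i p) = mono (Function.update ν i (p + 1)) := by
  rw [mono, X, monomial_mul, mono, one_mul]
  refine congrArg (fun d => monomial d (1 : ℝ)) (Finsupp.ext fun k => ?_)
  rcases eq_or_ne k i with rfl | h
  · simp [add_comm]
  · simp [h]

theorem X_mul_mono_setTwo_left (ν : Fin m → ℕ) {i j : Fin m} (h : i ≠ j) (p q : ℕ) :
    X i * mono (setTwo ν i j p q) = mono (setTwo ν i j (p + 1) q) := by
  rw [setTwo_comm _ h, setTwo_comm _ h, setTwo, X_mul_mono_update, setTwo]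

theorem X_mul_mono_setTwo_right (ν : Fin m → ℕ) (i j : Fin m) (p q : ℕ) :
    X j * mono (setTwo ν i j p q) = mono (setTwo ν i j p (q + 1)) := by
  rw [setTwo, X_mul_mono_update, setTwo]

/-- The finite geometric sum `(xᵏ - yᵏ) / (x - y)`, proved by telescoping. -/
theorem divDiff_mono_setTwo (ν : Fin m → ℕ) {i j : Fin m} (h : i ≠ j) (b k : ℕ) :
    divDiff i j (mono (setTwo ν i j (b + k) b)) =
      ∑ r ∈ Finset.range k, mono (setTwo ν i j (b + k - 1 - r) (b + r)) := by
  rw [divDiff_eq_iff h]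
  have h1 : rename (Equiv.swap i j) (mono (setTwo ν i j (b + k) b)) =
      mono (setTwo ν i j b (b + k)) := by
    rw [← setTwo_comp_swap ν h, rename_mono]
  have h2 : ∀ r ∈ Finset.range k, (X i - X j) * mono (setTwo ν i j (b + k - 1 - r) (b + r)) =
      mono (setTwo ν i j (b + k - r) (b + r)) -
        mono (setTwo ν i j (b + k - (r + 1)) (b + (r + 1))) := by
    intro r hr
    rw [Finset.mem_range] at hr
    rw [sub_mul, X_mul_mono_setTwo_left ν h, X_mul_mono_setTwo_right,
      show b + k - 1 - r + 1 = b + k - r by omega, show b + k - 1 - r = b + k - (r + 1) by omega,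
      add_assoc b r 1]
  rw [h1, Finset.mul_sum, Finset.sum_congr rfl h2,
    Finset.sum_range_sub' fun r => mono (setTwo ν i j (b + k - r) (b + r))]
  simp

/-- The geometric sum, multiplied by `X i`, starts with the monomial itself; all further terms have
an `i`-exponent strictly between the two old ones. -/
theorem X_mul_divDiff_mono_mem {W : Submodule ℝ (MvPolynomial (Fin m) ℝ)} {ν : Fin m → ℕ}
    {i j : Fin m} (h : i ≠ j) (hle : ν j ≤ ν i)
    (hW : ∀ p q, p + q = ν i + ν j → ν j < p → p < ν i → mono (setTwo ν i j p q) ∈ W) :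
    X i * divDiff i j (mono ν) - (if ν j < ν i then mono ν else 0) ∈ W := by
  obtain ⟨k, hk⟩ := Nat.exists_eq_add_of_le hle
  have hν : mono ν = mono (setTwo ν i j (ν j + k) (ν j)) := by rw [← hk, setTwo_self]
  nth_rewrite 1 [hν]
  rw [divDiff_mono_setTwo ν h, Finset.mul_sum]
  simp only [X_mul_mono_setTwo_left ν h]
  rcases k with _ | k
  · simp [hk]
  · rw [Finset.sum_range_succ', if_pos (by omega),
      show ν j + (k + 1) - 1 - 0 + 1 = ν j + (k + 1) by omega, add_zero, ← hν, add_sub_cancel_right]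
    refine Submodule.sum_mem _ fun r hr => hW _ _ ?_ ?_ ?_ <;>
    · rw [Finset.mem_range] at hr
      omega

/-- When the `j`-exponent is larger, the end term of the geometric sum is the swapped monomial with
a minus sign, and it cancels against the transposition in the Cherednik operator. -/
theorem X_mul_divDiff_mono_add_mem {W : Submodule ℝ (MvPolynomial (Fin m) ℝ)} {ν : Fin m → ℕ}
    {i j : Fin m} (h : i ≠ j) (hle : ν i ≤ ν j)
    (hW : ∀ p q, p + q = ν i + ν j → ν i < p → p < ν j → mono (setTwo ν i j p q) ∈ W) :
    X i * divDiff i j (mono ν) + rename (Equiv.swap i j) (mono ν) -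
      (if ν j = ν i then mono ν else 0) ∈ W := by
  obtain ⟨k, hk⟩ := Nat.exists_eq_add_of_le hle
  have hν : mono ν = mono (setTwo ν j i (ν i + k) (ν i)) := by rw [← hk, setTwo_self]
  have h1 : rename (Equiv.swap i j) (mono ν) = mono (setTwo ν j i (ν i) (ν i + k)) := by
    rw [hν, Equiv.swap_comm, ← setTwo_comp_swap ν h.symm, rename_mono]
  rw [h1, divDiff_comm j i]
  nth_rewrite 1 [hν]
  rw [divDiff_mono_setTwo ν h.symm, mul_neg, Finset.mul_sum]
  simp only [X_mul_mono_setTwo_right]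
  rcases k with _ | k
  · rw [if_pos (by omega), add_zero, Finset.range_zero, Finset.sum_empty]
    rw [add_zero] at hν
    rw [← hν]
    simp
  · rw [Finset.sum_range_succ, if_neg (by omega),
      show ν i + (k + 1) - 1 - k = ν i by omega, add_assoc (ν i) k 1, neg_add,
      neg_add_cancel_right, sub_zero]
    refine Submodule.neg_mem _ (Submodule.sum_mem _ fun r hr => ?_)
    rw [setTwo_comm _ h.symm]
    refine hW _ _ ?_ ?_ ?_ <;>
    · rw [Finset.mem_range] at hr
      omega

theorem X_mul_pderiv_mono (ν : Fin m → ℕ) (i : Fin m) :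
    X i * pderiv i (mono ν) = (ν i : ℝ) • mono ν := by
  refine ext_coeffAt fun μ => ?_
  rw [coeffAt_X_mul_pderiv, coeffAt_smul, coeffAt_mono]
  split_ifs with h
  · rw [h]
  · simp

/-- On a weakly increasing monomial, a Cherednik operator is diagonal up to terms that are lower
in the dominance order. -/
theorem cherednik_mono_sub_mem {W : Submodule ℝ (MvPolynomial (Fin m) ℝ)} (α : ℝ)
    {ν : Fin m → ℕ} (hν : Monotone ν) (i : Fin m)
    (hW : ∀ j, j ≠ i → ∀ p q, p + q = ν i + ν j → p < max (ν i) (ν j) → q < max (ν i) (ν j) →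
      mono (setTwo ν i j p q) ∈ W) :
    cherednik α i (mono ν) - bar α ν i • mono ν ∈ W := by
  have h1 : cherednik α i (mono ν) - bar α ν i • mono ν =
      ∑ j, (X i * divDiff i j (mono ν) + (if i < j then rename (Equiv.swap i j) (mono ν) else 0)
        - (if Below ν j i then mono ν else 0)) := by
    rw [cherednik_apply, dunkl_apply, Finset.sum_sub_distrib, Finset.sum_add_distrib,
      ← Finset.mul_sum, ← sum_Ioi_eq, ← Finset.sum_filter, Finset.sum_const, mul_add,
      mul_smul_comm, X_mul_pderiv_mono, smul_smul, bar, add_smul, rank, Nat.cast_smul_eq_nsmul]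
    abel
  rw [h1]
  refine Submodule.sum_mem _ fun j _ => ?_
  rcases lt_trichotomy i j with hij | rfl | hij
  · have hle := hν hij.le
    have hb : Below ν j i ↔ ν j = ν i := by unfold Below; omega
    rw [if_pos hij, if_congr hb rfl rfl]
    refine X_mul_divDiff_mono_add_mem hij.ne hle fun p q hpq h1 h2 => hW j hij.ne' p q hpq ?_ ?_
    all_goals rw [max_eq_right hle]; omega
  · simp [divDiff_self, not_below_self]
  · have hle := hν hij.le
    have hb : Below ν j i ↔ ν j < ν i := by unfold Below; omega
    rw [if_neg hij.not_gt, if_congr hb rfl rfl, add_zero]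
    refine X_mul_divDiff_mono_mem hij.ne' hle fun p q hpq h1 h2 => hW j hij.ne p q hpq ?_ ?_
    all_goals rw [max_eq_left hle]; omega

theorem dominated_setTwo {ν : Fin m → ℕ} {i j : Fin m} (hij : j ≠ i) {p q : ℕ}
    (hpq : p + q = ν i + ν j) (hp : p < max (ν i) (ν j)) (hq : q < max (ν i) (ν j)) :
    Dominated (sorted (setTwo ν i j p q)) (sorted ν) ∧
      ∑ k, setTwo ν i j p q k ^ 2 < ∑ k, ν k ^ 2 := by
  have hi : setTwo ν i j p q i = p := by simp [setTwo_apply, hij.symm]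
  have hj : setTwo ν i j p q j = q := by simp [setTwo_apply]
  rcases le_total (ν i) (ν j) with hle | hle
  · rw [max_eq_right hle] at hp hq
    have hoff : ∀ k, k ≠ j → k ≠ i → ν k = setTwo ν i j p q k := fun k h1 h2 => by
      simp [setTwo_apply, h1, h2]
    exact ⟨dominated_of_transfer hij hoff (by omega) (by omega) (by omega),
      sum_sq_lt_of_transfer hij hoff (by omega) (by omega) (by omega)⟩
  · rw [max_eq_left hle] at hp hq
    have hoff : ∀ k, k ≠ i → k ≠ j → ν k = setTwo ν i j p q k := fun k h1 h2 => by
      simp [setTwo_apply, h1, h2]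
    exact ⟨dominated_of_transfer hij.symm hoff (by omega) (by omega) (by omega),
      sum_sq_lt_of_transfer hij.symm hoff (by omega) (by omega) (by omega)⟩

/-- By permuting variables the exponent may be taken increasing. Then every `Yᵢ - ν̄ᵢ` sends the
monomial to strictly dominated orbits, so a nonzero coordinate outside those has the joint
eigenvalues of `ν`, that is, sits at `ν`. -/
theorem mono_mem_orbitSpan {α : ℝ} (hα : 0 < α) (ν : Fin (n + 1) → ℕ) :
    mono ν ∈ orbitSpan hα fun κ => Dominated κ (sorted ν) := by
  induction hN : ∑ k, ν k ^ 2 using Nat.strong_induction_on generalizing ν with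
  | _ N ih =>
    subst hN
    wlog hmono : Monotone ν generalizing ν
    · have h1 := this (ν ∘ Tuple.sort ν) (fun N hN ρ hρ => ih N (by
        rwa [← Equiv.sum_comp (Tuple.sort ν) fun k => ν k ^ 2]) ρ hρ) (Tuple.monotone_sort ν)
      rw [sorted_comp] at h1
      rw [← rename_mono (Tuple.sort ν)]
      exact rename_mem_orbitSpan _ h1
    have key : ∀ i, cherednik α i (mono ν) - bar α ν i • mono ν ∈
        orbitSpan hα fun κ => Dominated κ (sorted ν) ∧ κ ≠ sorted ν := by
      refine fun i => cherednik_mono_sub_mem α hmono i fun j hij p q hpq hp hq => ?_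
      obtain ⟨hd, hs⟩ := dominated_setTwo hij hpq hp hq
      refine orbitSpan_mono hα (fun κ hκ => ⟨hκ.trans hd, ?_⟩) (ih _ hs _ rfl)
      rintro rfl
      rw [← sum_sq_sorted ν, hκ.antisymm hd, sum_sq_sorted] at hs
      exact lt_irrefl _ hs
    intro η hη
    by_contra hne
    refine hη ?_
    have : η = ν := by
      refine eq_of_bar_eq hα fun i => ?_
      have h1 := key i η fun h => hη h.1
      rw [map_sub, map_smul, Finsupp.sub_apply, Finsupp.smul_apply, repr_cherednik, smul_eq_mul,
        ← sub_mul] at h1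
      exact sub_eq_zero.1 ((mul_eq_zero.1 h1).resolve_right hne)
    rw [this]
    exact Dominated.refl _

theorem jack_mem_orbitSpan_dominated {α : ℝ} (hα : 0 < α) (κ : MultiIndex (n + 1)) :
    jack α κ ∈ orbitSpan hα fun μ => Dominated μ κ := by
  rw [jack_eq_ofCoeff hα, ofCoeff_eq_sum_mono]
  refine Submodule.sum_mem _ fun ν _ => ?_
  by_cases h : Dominated (sorted ν) κ
  · exact Submodule.smul_mem _ _ (orbitSpan_mono hα (fun μ hμ => hμ.trans h)
      (mono_mem_orbitSpan hα ν))
  · rw [jackCoeff_of_not_dominated h, zero_smul]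
    exact Submodule.zero_mem _

theorem cherednik_of_isSymmetric (α : ℝ) {f : MvPolynomial (Fin m) ℝ} (hf : f.IsSymmetric)
    (i : Fin m) : cherednik α i f = α • (X i * pderiv i f) + ((Finset.Ioi i).card : ℝ) • f := by
  rw [cherednik_apply, dunkl_apply]
  simp only [divDiff_of_isSymmetric hf, Finset.sum_const_zero, add_zero, mul_smul_comm, hf _,
    Finset.sum_const, Nat.cast_smul_eq_nsmul]

/-- On symmetric `f`, `Yᵢ` is `α Xᵢ ∂ᵢ` plus a constant. In the second application the divided
differences over ordered pairs make up twice the sum over `i < j`, and the first-order terms `Xⱼ ∂ⱼ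
f` with index-dependent weights cancel. -/
theorem sum_cherednik_sq (α : ℝ) {f : MvPolynomial (Fin m) ℝ} (hf : f.IsSymmetric) :
    ∑ i, cherednik α i (cherednik α i f) = (2 * α) • lbPoly α f + α ^ 2 • ∑ i, X i * pderiv i f +
      (∑ i : Fin m, ((Finset.Ioi i).card : ℝ) ^ 2) • f := by
  set θ : Fin m → MvPolynomial (Fin m) ℝ := fun i => X i * pderiv i f with hθ
  have hs : ∀ i j, rename (Equiv.swap i j) (θ i) = θ j := fun i j => by
    simp only [hθ, map_mul, rename_X, rename_pderiv_of_isSymmetric hf, Equiv.swap_apply_left]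
  have hN : ∀ i j, divDiff j i (X j * θ j) = divDiff i j (X i * θ i) := fun i j => by
    have : X j * θ j = rename (Equiv.swap i j) (X i * θ i) := by
      rw [map_mul, hs, rename_X, Equiv.swap_apply_left]
    rw [this, divDiff_comm i j, divDiff_rename_swap, neg_neg]
  have hc : ∀ i, cherednik α i (θ i) = α • (X i * pderiv i (θ i)) +
      ∑ j ∈ {i}ᶜ, divDiff i j (X i * θ i) - ∑ j ∈ {i}ᶜ, θ j + ∑ j ∈ Finset.Ioi i, θ j := by
    intro i
    rw [cherednik_apply, dunkl_apply, mul_add, mul_smul_comm, Finset.mul_sum,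
      Finset.sum_congr rfl fun j _ => hs i j, ← Finset.add_sum_erase _ _ (Finset.mem_univ i),
      divDiff_self, LinearMap.zero_apply, mul_zero, zero_add, Finset.compl_singleton,
      add_sub_assoc, ← Finset.sum_sub_distrib]
    congr 2
    refine Finset.sum_congr rfl fun j hj => ?_
    rw [divDiff_X_mul_left (Finset.ne_of_mem_erase hj).symm (θ i), hs, add_sub_cancel_right]
  have e1 : ∑ i, ∑ j ∈ {i}ᶜ, divDiff i j (X i * θ i) =
      (2 : ℝ) • ∑ i, ∑ j ∈ Finset.Ioi i, divDiff i j (X i * θ i) := by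
    rw [← Finset.sum_sum_Ioi_add_eq_sum_sum_off_diag fun j i => divDiff i j (X i * θ i)]
    simp only [hN, two_smul, Finset.sum_add_distrib]
  have e2 : ∑ i, ∑ j ∈ ({i}ᶜ : Finset (Fin m)), θ j = ∑ i, ∑ j ∈ Finset.Ioi i, θ j +
      ∑ i, ((Finset.Ioi i).card : ℝ) • θ i := by
    rw [← Finset.sum_sum_Ioi_add_eq_sum_sum_off_diag fun j _ => θ j, ← Finset.sum_add_distrib]
    refine Finset.sum_congr rfl fun i _ => ?_
    rw [Finset.sum_add_distrib, Finset.sum_const, Nat.cast_smul_eq_nsmul]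
  have e3 : ∀ i, cherednik α i (cherednik α i f) = α • cherednik α i (θ i) +
      α • ((Finset.Ioi i).card : ℝ) • θ i + ((Finset.Ioi i).card : ℝ) ^ 2 • f := fun i => by
    conv_lhs => rw [cherednik_of_isSymmetric α hf, map_add, map_smul, map_smul,
      cherednik_of_isSymmetric α hf]
    simp only [hθ]
    module
  simp only [e3, hc, smul_add, smul_sub, Finset.sum_add_distrib, Finset.sum_sub_distrib,
    ← Finset.smul_sum, e1, e2]
  unfold lbPoly
  rw [← hθ]
  simp only [Finset.sum_sub_distrib, ← Finset.sum_smul]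
  module

theorem rank_of_antitone {κ : Fin m → ℕ} (hκ : Antitone κ) (i : Fin m) :
    rank κ i = (Finset.Ioi i).card := by
  rw [rank]
  congr 1
  ext j
  simp only [Finset.mem_filter, Finset.mem_univ, true_and, Finset.mem_Ioi]
  constructor
  · rintro (h | h)
    · by_contra hij
      exact absurd (hκ (not_lt.1 hij)) h.not_ge
    · exact h.1
  · intro h
    have := hκ h.le
    unfold Below
    omega

theorem sum_bar_sq_comp (α : ℝ) (w : Equiv.Perm (Fin (n + 1))) (η : Fin (n + 1) → ℕ) :
    ∑ i, bar α (η ∘ w) i ^ 2 = ∑ i, bar α η i ^ 2 := by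
  induction w using perm_induction generalizing η with
  | one => rfl
  | mul v w hv hw =>
    rw [← hv η, ← hw (η ∘ v)]
    rfl
  | adj i =>
    by_cases hne : η i.castSucc = η i.succ
    · have : η ∘ adj i = η := by
        ext k
        rw [Function.comp_apply]
        rcases eq_or_ne k i.castSucc with rfl | hk1
        · rw [adj_castSucc, hne]
        rcases eq_or_ne k i.succ with rfl | hk2
        · rw [adj_succ, hne]
        rw [adj_of_ne hk1 hk2]
      rw [this]
    · simp only [bar_comp_adj α hne]
      exact Equiv.sum_comp (adj i) fun k => bar α η k ^ 2

/-- The scalar counterpart of `sum_cherednik_sq`. The sum of squares is constant on orbits, so it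
can be computed at the sorted composition, where the rank is the number of later positions. -/
theorem sum_bar_sq (α : ℝ) (η : Fin (n + 1) → ℕ) :
    ∑ i, bar α η i ^ 2 = 2 * α * eigenvalue α (sorted η) + α ^ 2 * degree (sorted η) +
      ∑ i : Fin (n + 1), ((Finset.Ioi i).card : ℝ) ^ 2 := by
  obtain ⟨w, hw⟩ := exists_sorted_eq η
  rw [← sum_bar_sq_comp α w, ← hw, eigenvalue, degree]
  simp only [bar, rank_of_antitone (sorted η).2]
  push_cast
  simp only [Finset.mul_sum, ← Finset.sum_sub_distrib, ← Finset.sum_add_distrib]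
  refine Finset.sum_congr rfl fun i _ => ?_
  rw [Fin.card_Ioi]
  have : ((n + 1 - 1 - (i : ℕ) : ℕ) : ℝ) = (n : ℝ) - (i : ℕ) := by
    rw [Nat.add_sub_cancel, Nat.cast_sub (by have := i.2; omega)]
  rw [this]
  ring

/-- A Jack polynomial is a combination of the nonsymmetric ones in its orbit. -/
theorem jack_mem_orbitSpan {α : ℝ} (hα : 0 < α) (κ : MultiIndex (n + 1)) :
    jack α κ ∈ orbitSpan hα fun μ => μ = κ := by
  intro η hη
  by_contra hne
  have hJ := isJack_jack hα κ
  have hd : Dominated (sorted η) κ := by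
    by_contra h
    exact hne (jack_mem_orbitSpan_dominated hα κ η h)
  have h1 := sum_cherednik_sq α hJ.symmetric
  -- Euler's identity makes `∑ Yᵢ²` scalar on the Jack polynomial. At a nonzero coordinate the
  -- scalars must agree, which forces equal eigenvalues of `sorted η` and `κ`, contrary to strict
  -- monotonicity.
  rw [(eigen_iff hJ.symmetric).1 hJ.eigen, (isHomogeneous_jack hα κ).sum_X_mul_pderiv] at h1
  have h2 := congrArg (fun f => (nonsymBasis hα).repr f η) h1
  simp only [map_sum, Finsupp.coe_finsetSum, Finset.sum_apply, repr_cherednik, map_add, map_smul,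
    map_nsmul, Finsupp.add_apply, Finsupp.smul_apply, smul_eq_mul, ← mul_assoc] at h2
  rw [← Finset.sum_mul, nsmul_eq_mul, ← mul_assoc, ← add_mul, ← add_mul] at h2
  have h3 := mul_right_cancel₀ hne h2
  have h4 := sum_bar_sq α η
  simp only [← sq] at h3
  rw [h3, hd.1, add_left_inj, add_left_inj] at h4
  have h5 := hd.eigenvalue_lt hη hα
  rw [mul_left_cancel₀ (by positivity) h4] at h5
  exact lt_irrefl _ h5

/-! ### Lowering by `∑ ∂ᵢ` -/

theorem sum_repr_smul {α : ℝ} (hα : 0 < α) (f : MvPolynomial (Fin (n + 1)) ℝ) :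
    ∑ η ∈ ((nonsymBasis hα).repr f).support, (nonsymBasis hα).repr f η • nonsymJack α η = f := by
  conv_rhs => rw [← (nonsymBasis hα).linearCombination_repr f, Finsupp.linearCombination_apply,
    Finsupp.sum]
  simp only [nonsymBasis_apply]

/-- All coordinates in the orbit have the same sign by `exists_repr_comp_eq`, and their sum is
`J_κ(1) > 0` because every `E_η` has value `1` there. -/
theorem repr_jack_pos {α : ℝ} (hα : 0 < α) {κ : MultiIndex (n + 1)} {η : Fin (n + 1) → ℕ}
    (h : sorted η = κ) : 0 < (nonsymBasis hα).repr (jack α κ) η := by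
  have hs := (isJack_jack hα κ).symmetric
  have horb : ∀ ζ, sorted ζ = κ → ∃ r : ℝ, 0 < r ∧ (nonsymBasis hα).repr (jack α κ) ζ =
      r * (nonsymBasis hα).repr (jack α κ) η := by
    intro ζ hζ
    obtain ⟨w, rfl⟩ := exists_comp_eq_of_sorted_eq (hζ.trans h.symm)
    obtain ⟨r, hr, hrr⟩ := exists_repr_comp_eq hα w η
    exact ⟨r, hr, hrr _ hs⟩
  by_contra hneg
  rw [not_lt] at hneg
  have h1 := jackAtOne_pos hα κ
  rw [jackAtOne, ← sum_repr_smul hα (jack α κ), map_sum] at h1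
  refine absurd h1 (not_lt.2 (Finset.sum_nonpos fun ζ hζ => ?_))
  rw [smul_eval, (isNonsymJack_nonsymJack hα ζ).eval_one, mul_one]
  have hζκ : sorted ζ = κ := by
    by_contra hne
    exact Finsupp.mem_support_iff.1 hζ (jack_mem_orbitSpan hα κ ζ hne)
  obtain ⟨r, hr, e⟩ := horb ζ hζκ
  rw [e]
  exact mul_nonpos_of_nonneg_of_nonpos hr.le hneg

theorem eval_one_normalizedJack {α : ℝ} (hα : 0 < α) (κ : MultiIndex m) :
    eval (fun _ => 1) (normalizedJack α κ) = 1 := by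
  rw [normalizedJack, smul_eval, ← jackAtOne, inv_mul_cancel₀ (ne_of_gt (jackAtOne_pos hα κ))]

/-- A symmetric combination of the nonsymmetric Jack polynomials of one orbit is a multiple of the
Jack polynomial. -/
theorem eq_smul_normalizedJack {α : ℝ} (hα : 0 < α) {κ : MultiIndex (n + 1)}
    {f : MvPolynomial (Fin (n + 1)) ℝ} (hf : f.IsSymmetric)
    (hmem : f ∈ orbitSpan hα fun μ => μ = κ) :
    f = eval (fun _ => 1) f • normalizedJack α κ := by
  -- This `r` matches the coordinates at `κ` itself; for symmetric polynomials agreement at one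
  -- point of an orbit forces agreement on all of it.
  set r := (nonsymBasis hα).repr f κ.1 / (nonsymBasis hα).repr (jack α κ) κ.1 with hr
  have hJ := isJack_jack hα κ
  have h0 : f = r • jack α κ := by
    rw [← sub_eq_zero]
    have hsym : (f - r • jack α κ).IsSymmetric := fun w => by
      rw [map_sub, map_smul, hf w, hJ.symmetric w]
    apply (nonsymBasis hα).repr.injective
    rw [map_zero]
    ext η
    rw [Finsupp.zero_apply]
    by_cases h : sorted η = κ
    · obtain ⟨w, rfl⟩ := exists_comp_eq_of_sorted_eq (h.trans (sorted_self κ).symm)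
      obtain ⟨s, _, hs⟩ := exists_repr_comp_eq hα w κ.1
      rw [hs _ hsym, map_sub, map_smul, Finsupp.sub_apply, Finsupp.smul_apply, smul_eq_mul, hr,
        div_mul_cancel₀ _ (repr_jack_pos hα (sorted_self κ)).ne', sub_self, mul_zero]
    · exact Submodule.sub_mem _ hmem (Submodule.smul_mem _ _ (jack_mem_orbitSpan hα κ)) η h
  have h1 : eval (fun _ => 1) f = r * jackAtOne α κ := by
    rw [h0, smul_eval, jackAtOne]
  rw [h1, normalizedJack, smul_smul, mul_assoc, mul_inv_cancel₀ (jackAtOne_pos hα κ).ne', mul_one]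
  exact h0

/-- The sum of all permutations of a polynomial. -/
noncomputable def symmetrize :
    MvPolynomial (Fin m) ℝ →ₗ[ℝ] MvPolynomial (Fin m) ℝ :=
  ∑ w : Equiv.Perm (Fin m), (rename w).toLinearMap

theorem symmetrize_apply (f : MvPolynomial (Fin m) ℝ) :
    symmetrize f = ∑ w : Equiv.Perm (Fin m), rename w f := by
  simp [symmetrize]

theorem isSymmetric_symmetrize (f : MvPolynomial (Fin m) ℝ) : (symmetrize f).IsSymmetric := by
  intro w
  rw [symmetrize_apply, map_sum]
  simp only [rename_mul_apply]
  exact Equiv.sum_comp (Equiv.mulLeft w) fun v => rename (v : Equiv.Perm (Fin m)) f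

theorem symmetrize_rename (w : Equiv.Perm (Fin m)) (f : MvPolynomial (Fin m) ℝ) :
    symmetrize (rename w f) = symmetrize f := by
  rw [symmetrize_apply, symmetrize_apply]
  simp only [rename_mul_apply]
  exact Equiv.sum_comp (Equiv.mulRight w) fun v => rename (v : Equiv.Perm (Fin m)) f

theorem symmetrize_of_isSymmetric {f : MvPolynomial (Fin m) ℝ} (hf : f.IsSymmetric) :
    symmetrize f = (m.factorial : ℝ) • f := by
  rw [symmetrize_apply, Finset.sum_congr rfl fun w _ => hf w, Finset.sum_const, Finset.card_univ,
    Fintype.card_perm, Fintype.card_fin, Nat.cast_smul_eq_nsmul]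

theorem symmetrize_nonsymJack {α : ℝ} (hα : 0 < α) (η : Fin (n + 1) → ℕ) :
    symmetrize (nonsymJack α η) = ((n + 1).factorial : ℝ) • normalizedJack α (sorted η) := by
  have hmem : symmetrize (nonsymJack α η) ∈ orbitSpan hα fun μ => μ = sorted η := by
    rw [symmetrize_apply]
    exact Submodule.sum_mem _ fun w _ =>
      rename_mem_orbitSpan w (nonsymJack_mem_orbitSpan hα rfl)
  rw [eq_smul_normalizedJack hα (isSymmetric_symmetrize _) hmem]
  congr 1
  rw [symmetrize_apply, map_sum]
  have : ∀ w : Equiv.Perm (Fin (n + 1)), eval (fun _ => (1 : ℝ)) (rename w (nonsymJack α η)) = 1 :=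
    fun w => by
      rw [eval_rename]
      exact (isNonsymJack_nonsymJack hα η).eval_one
  simp only [this, Finset.sum_const, Finset.card_univ, Fintype.card_perm, Fintype.card_fin,
    nsmul_eq_mul, mul_one]

/-- The operator `∑ᵢ ∂/∂tᵢ`. -/
noncomputable def sumDeriv : MvPolynomial (Fin m) ℝ →ₗ[ℝ] MvPolynomial (Fin m) ℝ :=
  ∑ i, (pderiv i).toLinearMap

theorem sumDeriv_apply (f : MvPolynomial (Fin m) ℝ) : sumDeriv f = ∑ i, pderiv i f := by
  simp [sumDeriv]

/-- The partial derivatives of a symmetric polynomial are permuted by the variables, so they all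
have the same symmetrization and a single one suffices. -/
theorem smul_sumDeriv_of_isSymmetric {f : MvPolynomial (Fin m) ℝ} (hf : f.IsSymmetric)
    (k : Fin m) : (m.factorial : ℝ) • sumDeriv f = (m : ℝ) • symmetrize (pderiv k f) := by
  have hs : (sumDeriv f).IsSymmetric := fun w => by
    rw [sumDeriv_apply, map_sum]
    simp only [rename_pderiv_of_isSymmetric hf]
    exact Equiv.sum_comp w fun i => pderiv i f
  rw [← symmetrize_of_isSymmetric hs, sumDeriv_apply, map_sum]
  have : ∀ i, symmetrize (pderiv i f) = symmetrize (pderiv k f) := fun i => by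
    rw [← symmetrize_rename (Equiv.swap k i) (pderiv k f), rename_pderiv_of_isSymmetric hf,
      Equiv.swap_apply_left]
  simp only [this, Finset.sum_const, Finset.card_univ, Fintype.card_fin, Nat.cast_smul_eq_nsmul]

/-- The last Cherednik operator, which has no tail, is `α X_last ∂_last` on symmetric polynomials.
Terms with last entry zero have eigenvalue zero; the others are in the image of `phi`, so `X_last`
can be cancelled. -/
theorem smul_pderiv_last_jack {α : ℝ} (hα : 0 < α) (κ : MultiIndex (n + 1)) :
    α • pderiv (Fin.last n) (jack α κ) =
      ∑ η ∈ ((nonsymBasis hα).repr (jack α κ)).support with 0 < η (Fin.last n),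
        ((nonsymBasis hα).repr (jack α κ) η * bar α η (Fin.last n)) •
          rename (cyc n) (nonsymJack α (phiPred η)) := by
  refine mul_left_cancel₀ (X_ne_zero (Fin.last n)) ?_
  have h1 := cherednik_of_isSymmetric α (isJack_jack hα κ).symmetric (Fin.last n)
  have h2 : Finset.Ioi (Fin.last n) = ∅ := by ext; simp [Fin.le_last]
  rw [h2, Finset.card_empty, Nat.cast_zero, zero_smul, add_zero] at h1
  rw [mul_smul_comm, ← h1]
  conv_lhs => rw [← sum_repr_smul hα (jack α κ)]
  rw [map_sum, Finset.sum_filter, Finset.mul_sum]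
  refine Finset.sum_congr rfl fun η _ => ?_
  rw [map_smul, (isNonsymJack_nonsymJack hα η).eigen, smul_smul]
  split_ifs with h
  · rw [mul_smul_comm]
    congr 1
    conv_lhs => rw [← phiIndex_phiPred h, ← phi_nonsymJack hα, phi]
  · rw [bar_last_of_eq_zero α (by omega), mul_zero, zero_smul, mul_zero]

theorem sumDeriv_jack {α : ℝ} (hα : 0 < α) (κ : MultiIndex (n + 1)) :
    sumDeriv (jack α κ) =
      ∑ η ∈ ((nonsymBasis hα).repr (jack α κ)).support with 0 < η (Fin.last n),
        (((n + 1 : ℕ) : ℝ) / α * ((nonsymBasis hα).repr (jack α κ) η * bar α η (Fin.last n))) •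
          normalizedJack α (sorted (phiPred η)) := by
  have h1 := smul_sumDeriv_of_isSymmetric (isJack_jack hα κ).symmetric (Fin.last n)
  have h2 := congrArg symmetrize (smul_pderiv_last_jack hα κ)
  have hf : ((n + 1).factorial : ℝ) ≠ 0 := by positivity
  rw [map_smul, map_sum] at h2
  simp only [map_smul, symmetrize_rename, symmetrize_nonsymJack hα] at h2
  have h3 : symmetrize (pderiv (Fin.last n) (jack α κ)) = α⁻¹ • (α •
      symmetrize (pderiv (Fin.last n) (jack α κ))) := by
    rw [smul_smul, inv_mul_cancel₀ hα.ne', one_smul]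
  rw [h3, h2] at h1
  have h4 := congrArg (fun f => ((n + 1).factorial : ℝ)⁻¹ • f) h1
  simp only [smul_smul, inv_mul_cancel₀ hf, one_smul, Finset.smul_sum] at h4
  rw [h4]
  refine Finset.sum_congr rfl fun η _ => ?_
  congr 1
  field_simp

theorem degree_sorted_phiPred {η : Fin (n + 1) → ℕ} (h : 0 < η (Fin.last n)) :
    degree (sorted (phiPred η)) + 1 = ∑ i, η i := by
  conv_rhs => rw [← phiIndex_phiPred h, sum_phiIndex]
  rw [degree_sorted]

/-- `∑ᵢ ∂/∂tᵢ` maps a normalized Jack polynomial to a nonnegative combination of those of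
degree one less, with positive coefficients at the contiguous multi-indices. -/
theorem exists_sumDeriv_normalizedJack {α : ℝ} (hα : 0 < α) (κ : MultiIndex m) :
    ∃ β : MultiIndex m → ℝ, (∀ σ, 0 ≤ β σ) ∧ (∀ σ, β σ ≠ 0 → degree σ + 1 = degree κ) ∧
      (∀ σ i, raise σ i = κ.1 → 0 < β σ) ∧
      sumDeriv (normalizedJack α κ) =
        ∑ σ ∈ ofDegree m (degree κ - 1), β σ • normalizedJack α σ := by
  classical
  -- The spectral argument needs a last variable. For `m = 0` the sum of derivatives is empty and
  -- there is no index to raise, so `β = 0` serves.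
  rcases m with _ | n
  · refine ⟨0, fun _ => le_rfl, fun _ h => absurd rfl h, fun _ i => i.elim0, ?_⟩
    rw [sumDeriv_apply]
    simp
  have hJ1 := jackAtOne_pos hα κ
  set T := (((nonsymBasis hα).repr (jack α κ)).support).filter (fun η => 0 < η (Fin.last n))
    with hT
  set g : (Fin (n + 1) → ℕ) → ℝ := fun η => (jackAtOne α κ)⁻¹ * (((n + 1 : ℕ) : ℝ) / α *
    ((nonsymBasis hα).repr (jack α κ) η * bar α η (Fin.last n))) with hg
  have hsort : ∀ η ∈ T, sorted η = κ := fun η hη => by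
    by_contra hne
    exact Finsupp.mem_support_iff.1 (Finset.mem_filter.1 hη).1 (jack_mem_orbitSpan hα κ η hne)
  have hpos : ∀ η ∈ T, 0 < g η := fun η hη => by
    have h1 := repr_jack_pos hα (hsort η hη)
    have h2 := bar_pos hα (Finset.mem_filter.1 hη).2
    simp only [hg]
    positivity
  have hdeg : ∀ η ∈ T, degree (sorted (phiPred η)) + 1 = degree κ := fun η hη => by
    rw [degree_sorted_phiPred (Finset.mem_filter.1 hη).2, ← degree_sorted, hsort η hη]
  refine ⟨fun σ => ∑ η ∈ T with sorted (phiPred η) = σ, g η, fun σ => ?_, fun σ hσ => ?_,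
    fun σ i hi => ?_, ?_⟩
  · exact Finset.sum_nonneg fun η hη => (hpos η (Finset.mem_filter.1 hη).1).le
  · obtain ⟨η, hη, _⟩ := Finset.exists_ne_zero_of_sum_ne_zero hσ
    rw [Finset.mem_filter] at hη
    rw [← hη.2, hdeg η hη.1]
  -- The witness is `κ` with its `i`-th entry swapped into the last place; `phiPred` lowers that
  -- entry by one and leaves a rearrangement of `σ`.
  · refine Finset.sum_pos (fun η hη => hpos η (Finset.mem_filter.1 hη).1)
      ⟨κ.1 ∘ Equiv.swap i (Fin.last n), ?_⟩
    have hκi : κ.1 i = σ.1 i + 1 := by rw [← hi]; simp [raise]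
    have hlast : (κ.1 ∘ Equiv.swap i (Fin.last n)) (Fin.last n) = σ.1 i + 1 := by
      rw [Function.comp_apply, Equiv.swap_apply_right, hκi]
    rw [Finset.mem_filter, hT, Finset.mem_filter, Finsupp.mem_support_iff]
    refine ⟨⟨(repr_jack_pos hα (by rw [sorted_comp, sorted_self])).ne', by rw [hlast]; omega⟩, ?_⟩
    have : phiPred (κ.1 ∘ Equiv.swap i (Fin.last n)) =
        σ.1 ∘ (Equiv.swap i (Fin.last n) * cyc n : Equiv.Perm (Fin (n + 1))) := by
      have h0 : (Equiv.swap i (Fin.last n) * cyc n : Equiv.Perm (Fin (n + 1))) 0 = i := by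
        rw [Equiv.Perm.mul_apply, cyc_zero, Equiv.swap_apply_right]
      ext k
      rcases eq_or_ne k 0 with rfl | hk
      · rw [phiPred, Function.update_self, hlast, Function.comp_apply, h0]; rfl
      · rw [phiPred, Function.update_of_ne hk, ← hi, raise]
        have : (Equiv.swap i (Fin.last n) * cyc n : Equiv.Perm (Fin (n + 1))) k ≠ i := fun e =>
          hk (Equiv.injective _ (e.trans h0.symm))
        exact Function.update_of_ne this _ _
    rw [this, sorted_comp, sorted_self]
  · rw [normalizedJack, map_smul, sumDeriv_jack hα, ← hT, Finset.smul_sum]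
    simp only [smul_smul]
    rw [← Finset.sum_fiberwise_of_maps_to (s := T) (t := ofDegree (n + 1) (degree κ - 1))
      (g := fun η => sorted (phiPred η))
      (fun η hη => by rw [mem_ofDegree]; have := hdeg η hη; omega)]
    refine Finset.sum_congr rfl fun σ _ => ?_
    rw [Finset.sum_smul]
    refine Finset.sum_congr rfl fun η hη => ?_
    rw [(Finset.mem_filter.1 hη).2]

/-- Jack polynomials of different indices have disjoint supports in the nonsymmetric basis, and the
coordinate of each one at its own index is positive. -/
theorem linearIndependent_normalizedJack {α : ℝ} (hα : 0 < α) :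
    LinearIndependent ℝ (normalizedJack α : MultiIndex m → MvPolynomial (Fin m) ℝ) := by
  classical
  rcases m with _ | n
  · have : Subsingleton (MultiIndex 0) := inferInstance
    rw [linearIndependent_subsingleton_index_iff]
    intro κ h
    have := eval_one_normalizedJack hα κ
    rw [h, map_zero] at this
    exact zero_ne_one this
  rw [linearIndependent_iff']
  intro s c hc σ hσ
  have h1 := congrArg (fun f => (nonsymBasis hα).repr f σ.1) hc
  simp only [map_sum, Finsupp.coe_finsetSum, Finset.sum_apply, map_smul, Finsupp.smul_apply,
    map_zero, Finsupp.zero_apply, normalizedJack, smul_eq_mul] at h1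
  rw [Finset.sum_eq_single_of_mem σ hσ fun τ _ hτ => by
    rw [jack_mem_orbitSpan hα τ σ.1 (by rw [sorted_self]; exact hτ.symm), mul_zero, mul_zero]] at h1
  have h2 := repr_jack_pos hα (sorted_self σ)
  have h3 := inv_pos.2 (jackAtOne_pos hα σ)
  exact (mul_eq_zero.1 h1).resolve_right (ne_of_gt (mul_pos h3 h2))

/-! ### The generalized binomial coefficients -/

theorem sumDeriv_mul_X (f : MvPolynomial (Fin m) ℝ) (i : Fin m) :
    sumDeriv (f * X i) = sumDeriv f * X i + f := by
  rw [sumDeriv_apply, sumDeriv_apply]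
  simp only [pderiv_mul, pderiv_X, Finset.sum_add_distrib, ← Finset.sum_mul, ← Finset.mul_sum]
  simp [Pi.single_apply]

theorem sumDeriv_pow_mul_X (f : MvPolynomial (Fin m) ℝ) (i : Fin m) (k : ℕ) :
    (sumDeriv ^ (k + 1)) (f * X i) =
      (sumDeriv ^ (k + 1)) f * X i + ((k + 1 : ℕ) : ℝ) • (sumDeriv ^ k) f := by
  induction k with
  | zero => simp [sumDeriv_mul_X]
  | succ k ih =>
    rw [pow_succ' _ (k + 1), Module.End.mul_apply, ih, map_add, map_smul, sumDeriv_mul_X,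
      ← Module.End.mul_apply, ← pow_succ', ← Module.End.mul_apply, ← pow_succ']
    push_cast
    module

/-- Taylor's formula for the translation by `(1, …, 1)`. -/
theorem shift_eq_sum_sumDeriv (f : MvPolynomial (Fin m) ℝ) :
    ∃ N₀, ∀ N ≥ N₀, shift f = ∑ k ∈ Finset.range N, (k.factorial : ℝ)⁻¹ • (sumDeriv ^ k) f := by
  induction f using MvPolynomial.induction_on with
  | C a =>
    refine ⟨1, fun N hN => ?_⟩
    obtain ⟨N, rfl⟩ := Nat.exists_eq_add_of_le' hN
    have h0 : sumDeriv (C a : MvPolynomial (Fin m) ℝ) = 0 := by simp [sumDeriv_apply]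
    rw [Finset.sum_range_succ', Finset.sum_eq_zero fun k _ => by
      rw [pow_succ, Module.End.mul_apply, h0, map_zero, smul_zero]]
    simp [shift]
  | add p q hp hq =>
    obtain ⟨N₁, h₁⟩ := hp
    obtain ⟨N₂, h₂⟩ := hq
    refine ⟨max N₁ N₂, fun N hN => ?_⟩
    have h := congrArg₂ (· + ·) (h₁ N (le_of_max_le_left hN)) (h₂ N (le_of_max_le_right hN))
    simp only [← Finset.sum_add_distrib, ← smul_add, ← map_add] at h
    rw [← h, shift, shift, shift, map_add]
  | mul_X p i hp =>
    obtain ⟨N₀, h₀⟩ := hp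
    refine ⟨N₀ + 1, fun N hN => ?_⟩
    obtain ⟨N, rfl⟩ := Nat.exists_eq_add_of_le' (Nat.one_le_of_lt hN)
    have h1 := h₀ N (by omega)
    have h2 := h₀ (N + 1) (by omega)
    have h3 : shift (p * X i) = shift p * (X i + 1) := by simp [shift]
    rw [h3, mul_add, mul_one]
    nth_rewrite 1 [h2]
    rw [h1, Finset.sum_range_succ', Finset.sum_range_succ', add_mul, Finset.sum_mul]
    simp only [sumDeriv_pow_mul_X, smul_add, Finset.sum_add_distrib]
    have h4 : ∀ k : ℕ, ((k + 1).factorial : ℝ)⁻¹ • ((k + 1 : ℕ) : ℝ) • (sumDeriv ^ k) p =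
        (k.factorial : ℝ)⁻¹ • (sumDeriv ^ k) p := fun k => by
      rw [smul_smul]
      congr 1
      rw [Nat.factorial_succ]
      push_cast
      have : (k.factorial : ℝ) ≠ 0 := by positivity
      field_simp
    simp only [h4, smul_mul_assoc, pow_zero, Module.End.one_apply]
    abel

/-- Nonnegative matrices have nonnegative powers. The condition `degree σ + k = degree κ` makes all
coefficients vanish once `k` exceeds the degree, where `degree κ - k` is truncated. -/
theorem exists_sumDeriv_pow_normalizedJack {α : ℝ} (hα : 0 < α) (k : ℕ) (κ : MultiIndex m) :
    ∃ β : MultiIndex m → ℝ, (∀ σ, 0 ≤ β σ) ∧ (∀ σ, β σ ≠ 0 → degree σ + k = degree κ) ∧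
      (∀ σ i, k = 1 → raise σ i = κ.1 → 0 < β σ) ∧
      (sumDeriv ^ k) (normalizedJack α κ) =
        ∑ σ ∈ ofDegree m (degree κ - k), β σ • normalizedJack α σ := by
  classical
  induction k generalizing κ with
  | zero =>
    refine ⟨fun σ => if σ = κ then 1 else 0, fun σ => ?_, fun σ h => ?_, fun _ _ h => by simp at h,
      ?_⟩
    · dsimp only
      split_ifs <;> norm_num
    · by_cases e : σ = κ
      · rw [e, add_zero]
      · simp [e] at h
    · simp [mem_ofDegree]
  | succ k ih =>
    obtain ⟨β, hβ0, hβd, hβp, hβ⟩ := exists_sumDeriv_normalizedJack hα κ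
    rcases k with _ | k
    · exact ⟨β, hβ0, hβd, fun σ i _ => hβp σ i, by rw [zero_add, pow_one]; exact hβ⟩
    choose γ hγ0 hγd _ hγ using ih
    refine ⟨fun σ => ∑ τ ∈ ofDegree m (degree κ - 1), β τ * γ τ σ, fun σ => ?_, fun σ h => ?_,
      fun _ _ h => by omega, ?_⟩
    · exact Finset.sum_nonneg fun τ _ => mul_nonneg (hβ0 τ) (hγ0 τ σ)
    · obtain ⟨τ, _, hτ⟩ := Finset.exists_ne_zero_of_sum_ne_zero h
      have h1 := hβd τ (left_ne_zero_of_mul hτ)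
      have h2 := hγd τ σ (right_ne_zero_of_mul hτ)
      omega
    · rw [pow_succ, Module.End.mul_apply, hβ, map_sum]
      have h1 : ∀ τ ∈ ofDegree m (degree κ - 1),
          (sumDeriv ^ (k + 1)) (β τ • normalizedJack α τ) =
            ∑ σ ∈ ofDegree m (degree κ - (k + 1 + 1)), (β τ * γ τ σ) • normalizedJack α σ := by
        intro τ hτ
        rw [mem_ofDegree] at hτ
        rw [map_smul, hγ, hτ, Finset.smul_sum, show degree κ - 1 - (k + 1) =
          degree κ - (k + 1 + 1) by omega]
        simp only [smul_smul]
      rw [Finset.sum_congr rfl h1, Finset.sum_comm]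
      simp only [Finset.sum_smul]

theorem exists_isBinomialFamily {α : ℝ} (hα : 0 < α) (κ : MultiIndex m) :
    ∃ b : MultiIndex m → ℝ, IsBinomialFamily α κ b ∧ (∀ σ, 0 ≤ b σ) ∧
      ∀ σ i, raise σ i = κ.1 → 0 < b σ := by
  choose β hβ0 hβd hβp hβ using fun k => exists_sumDeriv_pow_normalizedJack hα k κ
  -- Only the Taylor term of order `k = |κ| - |σ|`, with its factor `1 / k!`, reaches the degree of
  -- `σ`.
  refine ⟨fun σ => if degree σ ≤ degree κ then
    ((degree κ - degree σ).factorial : ℝ)⁻¹ * β (degree κ - degree σ) σ else 0,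
    ⟨?_, fun σ h => if_neg h.not_ge⟩, fun σ => ?_, fun σ i hi => ?_⟩
  · obtain ⟨N₀, hN⟩ := shift_eq_sum_sumDeriv (normalizedJack α κ)
    rw [hN (max N₀ (degree κ + 1)) (le_max_left _ _)]
    have hzero : ∀ k, degree κ < k → (sumDeriv ^ k) (normalizedJack α κ) = 0 := fun k hk => by
      rw [hβ]
      refine Finset.sum_eq_zero fun σ _ => ?_
      have : β k σ = 0 := by
        by_contra h
        have := hβd k σ h
        omega
      rw [this, zero_smul]
    -- Terms of order above `|κ|` vanish; reversing the remaining range replaces the order `k` by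
    -- the degree `s = |κ| - k`.
    rw [← Finset.sum_subset (Finset.range_mono (le_max_right N₀ (degree κ + 1))) fun k _ hk => by
      rw [hzero k (by simpa using hk), smul_zero], ← Finset.sum_range_reflect]
    refine Finset.sum_congr rfl fun s hs => ?_
    have hs' : s ≤ degree κ := by
      have := Finset.mem_range.1 hs
      omega
    rw [hβ, show degree κ - (degree κ + 1 - 1 - s) = s by omega, Finset.smul_sum]
    refine Finset.sum_congr rfl fun σ hσ => ?_
    rw [mem_ofDegree] at hσ
    rw [hσ, if_pos hs', smul_smul, show degree κ + 1 - 1 - s = degree κ - s by omega]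
  · dsimp only
    split_ifs
    · exact mul_nonneg (by positivity) (hβ0 _ σ)
    · exact le_rfl
  · have hd : degree κ = degree σ + 1 := by
      rw [degree, ← hi, degree, raise, Finset.sum_update_of_mem (Finset.mem_univ i),
        ← Finset.add_sum_erase _ _ (Finset.mem_univ i), Finset.sdiff_singleton_eq_erase]
      omega
    dsimp only
    rw [hd, if_pos (by omega), Nat.add_sub_cancel_left]
    have := hβp 1 σ i rfl hi
    positivity

theorem IsBinomialFamily.unique {α : ℝ} (hα : 0 < α) {κ : MultiIndex m} {b b' : MultiIndex m → ℝ}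
    (h : IsBinomialFamily α κ b) (h' : IsBinomialFamily α κ b') : b = b' := by
  classical
  have hsum : ∀ c : MultiIndex m → ℝ, ∑ s ∈ Finset.range (degree κ + 1), ∑ σ ∈ ofDegree m s,
      c σ • normalizedJack α σ = ∑ σ ∈ (Finset.range (degree κ + 1)).biUnion (ofDegree m),
        c σ • normalizedJack α σ := fun c => by
    rw [Finset.sum_biUnion]
    intro s _ t _ hst
    refine Finset.disjoint_left.2 fun σ h1 h2 => hst ?_
    rw [mem_ofDegree] at h1 h2
    rw [← h1, ← h2]
  ext σ
  by_cases hσ : degree κ < degree σ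
  · rw [h.eq_zero σ hσ, h'.eq_zero σ hσ]
  have h1 := h.expansion.symm.trans h'.expansion
  rw [hsum, hsum, ← sub_eq_zero, ← Finset.sum_sub_distrib] at h1
  simp only [← sub_smul] at h1
  refine sub_eq_zero.1 (linearIndependent_iff'.1 (linearIndependent_normalizedJack hα) _ _ h1 σ ?_)
  rw [Finset.mem_biUnion]
  exact ⟨degree σ, Finset.mem_range.2 (by omega), mem_ofDegree.2 rfl⟩

theorem isBinomialFamily_binomial {α : ℝ} (hα : 0 < α) (κ : MultiIndex m) :
    IsBinomialFamily α κ (binomial α κ) := by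
  have h : ∃ b, IsBinomialFamily α κ b := (exists_isBinomialFamily hα κ).imp fun _ h => h.1
  have : binomial α κ = h.choose := by
    ext σ
    rw [binomial, dif_pos h]
  rw [this]
  exact h.choose_spec

theorem existsUnique_isBinomialFamily {α : ℝ} (hα : 0 < α) (κ : MultiIndex m) :
    ∃! b : MultiIndex m → ℝ, IsBinomialFamily α κ b :=
  ⟨_, isBinomialFamily_binomial hα κ, fun _ h => h.unique hα (isBinomialFamily_binomial hα κ)⟩

theorem binomial_nonneg {α : ℝ} (hα : 0 < α) (κ σ : MultiIndex m) : 0 ≤ binomial α κ σ := by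
  obtain ⟨b, hb, h0, _⟩ := exists_isBinomialFamily hα κ
  rw [(isBinomialFamily_binomial hα κ).unique hα hb]
  exact h0 σ

theorem binomial_raise_pos {α : ℝ} (hα : 0 < α) {κ σ : MultiIndex m} {i : Fin m}
    (h : raise σ i = κ.1) : 0 < binomial α κ σ := by
  obtain ⟨b, hb, _, hp⟩ := exists_isBinomialFamily hα κ
  rw [(isBinomialFamily_binomial hα κ).unique hα hb]
  exact hp σ i h

/-! ### Rationality -/

/-- `f` agrees on `(0, ∞)` with a rational function over `ℚ` without poles there. -/
def IsRational (f : ℝ → ℝ) : Prop :=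
  ∃ p q : Polynomial ℚ, ∀ α : ℝ, 0 < α →
    Polynomial.aeval α q ≠ 0 ∧ f α = Polynomial.aeval α p / Polynomial.aeval α q

namespace IsRational

variable {f g : ℝ → ℝ}

theorem congr (hf : IsRational f) (h : ∀ α, 0 < α → g α = f α) : IsRational g := by
  obtain ⟨p, q, hpq⟩ := hf
  exact ⟨p, q, fun α hα => ⟨(hpq α hα).1, by rw [h α hα, (hpq α hα).2]⟩⟩

theorem const (r : ℚ) : IsRational fun _ => (r : ℝ) :=
  ⟨Polynomial.C r, 1, fun α _ => by simp⟩

theorem natCast (k : ℕ) : IsRational fun _ => (k : ℝ) := by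
  simpa using const (k : ℚ)

theorem param : IsRational fun α => α := ⟨Polynomial.X, 1, fun α _ => by simp⟩

theorem add (hf : IsRational f) (hg : IsRational g) : IsRational fun α => f α + g α := by
  obtain ⟨p, q, h⟩ := hf
  obtain ⟨p', q', h'⟩ := hg
  refine ⟨p * q' + q * p', q * q', fun α hα => ?_⟩
  obtain ⟨h1, h2⟩ := h α hα
  obtain ⟨h3, h4⟩ := h' α hα
  simp only [map_mul, map_add]
  exact ⟨mul_ne_zero h1 h3, by rw [h2, h4, div_add_div _ _ h1 h3]⟩

theorem mul (hf : IsRational f) (hg : IsRational g) : IsRational fun α => f α * g α := by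
  obtain ⟨p, q, h⟩ := hf
  obtain ⟨p', q', h'⟩ := hg
  refine ⟨p * p', q * q', fun α hα => ?_⟩
  obtain ⟨h1, h2⟩ := h α hα
  obtain ⟨h3, h4⟩ := h' α hα
  simp only [map_mul]
  exact ⟨mul_ne_zero h1 h3, by rw [h2, h4, div_mul_div_comm]⟩

theorem sub (hf : IsRational f) (hg : IsRational g) : IsRational fun α => f α - g α :=
  (hf.add ((const (-1)).mul hg)).congr fun α _ => by push_cast; ring

theorem inv (hf : IsRational f) (h0 : ∀ α, 0 < α → f α ≠ 0) : IsRational fun α => (f α)⁻¹ := by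
  obtain ⟨p, q, h⟩ := hf
  refine ⟨q, p, fun α hα => ?_⟩
  obtain ⟨h1, h2⟩ := h α hα
  refine ⟨fun e => h0 α hα ?_, by simp only [h2, inv_div]⟩
  rw [h2, e, zero_div]

theorem sum {ι : Type*} (s : Finset ι) {F : ι → ℝ → ℝ} (h : ∀ i ∈ s, IsRational (F i)) :
    IsRational fun α => ∑ i ∈ s, F i α := by
  classical
  induction s using Finset.induction_on with
  | empty => simpa using const 0
  | insert a s ha ih =>
    simp only [Finset.sum_insert ha]
    exact (h a (Finset.mem_insert_self _ _)).add
      (ih fun i hi => h i (Finset.mem_insert_of_mem hi))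

theorem prod {ι : Type*} (s : Finset ι) {F : ι → ℝ → ℝ} (h : ∀ i ∈ s, IsRational (F i)) :
    IsRational fun α => ∏ i ∈ s, F i α := by
  classical
  induction s using Finset.induction_on with
  | empty => simpa using const 1
  | insert a s ha ih =>
    simp only [Finset.prod_insert ha]
    exact (h a (Finset.mem_insert_self _ _)).mul
      (ih fun i hi => h i (Finset.mem_insert_of_mem hi))

theorem exists_rat (hf : IsRational f) {α : ℚ} (hα : 0 < α) : ∃ r : ℚ, f α = r := by
  obtain ⟨p, q, h⟩ := hf
  refine ⟨p.eval α / q.eval α, ?_⟩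
  have e : ∀ p : Polynomial ℚ, Polynomial.aeval (α : ℝ) p = ((p.eval α : ℚ) : ℝ) := fun p => by
    have := Polynomial.aeval_algebraMap_apply ℝ α p
    simpa using this
  rw [(h α (by exact_mod_cast hα)).2, e, e]
  push_cast
  rfl

end IsRational

theorem isRational_lowerHookProduct (κ : MultiIndex m) :
    IsRational fun α => lowerHookProduct α κ := by
  unfold lowerHookProduct
  refine IsRational.prod _ fun i _ => IsRational.prod _ fun j _ => ?_
  refine ((IsRational.natCast _).add ?_).add (IsRational.param.mul ((IsRational.natCast _).sub
    ((IsRational.natCast _).add ?_))) <;> simpa using IsRational.const 1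

theorem isRational_eigenvalue (κ : MultiIndex m) : IsRational fun α => eigenvalue α κ := by
  have h1 : IsRational fun α : ℝ =>
      α * (∑ i : Fin m, (κ.1 i : ℝ) * ((κ.1 i : ℝ) - 1) / 2) := by
    refine (IsRational.param.mul (IsRational.const
      (∑ i : Fin m, (κ.1 i : ℚ) * ((κ.1 i : ℚ) - 1) / 2))).congr fun α _ => ?_
    push_cast; rfl
  have h2 : IsRational fun _ : ℝ => - (∑ i : Fin m, ((i : ℕ) : ℝ) * (κ.1 i : ℝ)) +
      ((m : ℝ) - 1) * (degree κ : ℝ) := by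
    refine (IsRational.const (- (∑ i : Fin m, ((i : ℕ) : ℚ) * (κ.1 i : ℚ)) +
      ((m : ℚ) - 1) * (degree κ : ℚ))).congr fun α _ => ?_
    push_cast; rfl
  refine (h1.add h2).congr fun α _ => ?_
  rw [eigenvalue]; ring

theorem isRational_jackCoeff (κ μ : MultiIndex m) : IsRational fun α => jackCoeff α κ μ := by
  induction μ using raise_induction with
  | h μ ih =>
    by_cases h : Dominated μ κ
    · rcases eq_or_ne μ κ with rfl | hne
      · exact (isRational_lowerHookProduct _).congr fun α _ => jackCoeff_self α _
      · refine ((((isRational_eigenvalue κ).sub (isRational_eigenvalue μ)).inv fun α hα =>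
          (sub_pos.2 (h.eigenvalue_lt hne hα)).ne').mul ?_).congr
          fun α _ => jackCoeff_of_ne hne h
        unfold raiseSum
        refine IsRational.sum _ fun i _ => IsRational.sum _ fun j hj =>
          IsRational.sum _ fun b hb => ?_
        refine IsRational.mul ?_ (ih i j b (Finset.mem_Ioi.1 hj) (Finset.mem_range.1 hb))
        refine (IsRational.const ((μ.1 i : ℚ) + μ.1 j - 2 * b)).congr fun α _ => ?_
        push_cast; rfl
    · exact (IsRational.const 0).congr fun α _ => by rw [jackCoeff_of_not_dominated h]; simp

theorem isRational_jackAtOne (κ : MultiIndex m) : IsRational fun α => jackAtOne α κ :=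
  (IsRational.sum _ fun ν _ => isRational_jackCoeff κ (sorted ν)).congr fun _ hα =>
    jackAtOne_eq hα κ

theorem isRational_inv_jackAtOne (κ : MultiIndex m) : IsRational fun α => (jackAtOne α κ)⁻¹ :=
  (isRational_jackAtOne κ).inv fun _ hα => (jackAtOne_pos hα κ).ne'

theorem coeffAt_normalizedJack {α : ℝ} (hα : 0 < α) (κ : MultiIndex m) (ν : Fin m → ℕ) :
    coeffAt ν (normalizedJack α κ) = (jackAtOne α κ)⁻¹ * jackCoeff α κ (sorted ν) := by
  rw [normalizedJack, coeffAt_smul, coeffAt_jack hα]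

theorem exists_rat_coeffAt_shift_mono (μ ν : Fin m → ℕ) :
    ∃ r : ℚ, coeffAt μ (shift (mono ν)) = r := by
  refine ⟨coeff (Finsupp.equivFunOnFinite.symm μ) (∏ i, (X i + 1) ^ ν i), ?_⟩
  have h1 : shift (mono ν) =
      map (algebraMap ℚ ℝ) (∏ i : Fin m, (X i + 1) ^ ν i : MvPolynomial (Fin m) ℚ) := by
    rw [shift, mono, aeval_monomial]
    simp [Finsupp.prod_fintype]
  rw [coeffAt, h1, coeff_map]
  rfl

theorem isRational_coeffAt_shift (κ : MultiIndex m) (μ : Fin m → ℕ) :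
    IsRational fun α => coeffAt μ (shift (normalizedJack α κ)) := by
  choose r hr using exists_rat_coeffAt_shift_mono (m := m) μ
  refine ((isRational_inv_jackAtOne κ).mul (IsRational.sum
    (Finset.piAntidiag (Finset.univ : Finset (Fin m)) (degree κ)) fun ν _ =>
      (isRational_jackCoeff κ (sorted ν)).mul (IsRational.const (r ν)))).congr fun α hα => ?_
  rw [normalizedJack, jack_eq_ofCoeff hα, ofCoeff_eq_sum_mono, shift, map_smul, map_sum,
    coeffAt_smul, coeffAt_sum]
  congr 1
  refine Finset.sum_congr rfl fun ν _ => ?_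
  rw [map_smul, coeffAt_smul, ← hr ν]
  rfl

/-- By homogeneity only the `σ` with the degree of `μ` contribute. This is the linear system from
which the binomial coefficients are computed. -/
theorem coeffAt_shift_normalizedJack {α : ℝ} (hα : 0 < α) (κ μ : MultiIndex m)
    (h : degree μ ≤ degree κ) : coeffAt μ.1 (shift (normalizedJack α κ)) =
      ∑ σ ∈ ofDegree m (degree μ), binomial α κ σ * coeffAt μ.1 (normalizedJack α σ) := by
  rw [(isBinomialFamily_binomial hα κ).expansion, coeffAt_sum,
    Finset.sum_eq_single_of_mem (degree μ) (Finset.mem_range.2 (by omega)), coeffAt_sum]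
  · simp only [coeffAt_smul]
  · intro s _ hs
    rw [coeffAt_sum]
    refine Finset.sum_eq_zero fun σ hσ => ?_
    rw [coeffAt_smul, coeffAt_normalizedJack hα, sorted_self, jackCoeff_of_not_dominated, mul_zero,
      mul_zero]
    intro hd
    rw [mem_ofDegree] at hσ
    exact hs (by rw [← hσ, hd.1])

/-- In the equation at `μ` the other unknowns with nonzero coefficient belong to `σ` strictly
dominating `μ`, whose measure is smaller. The equation can thus be solved for the unknown at `μ`,
with the positive leading coefficient of the normalized Jack polynomial of `μ` as pivot. -/
theorem isRational_binomial (κ μ : MultiIndex m) : IsRational fun α => binomial α κ μ := by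
  classical
  by_cases hdeg : degree κ < degree μ
  · exact (IsRational.const 0).congr fun α hα => by
      rw [(isBinomialFamily_binomial hα κ).eq_zero μ hdeg]; simp
  induction hN : degree μ ^ 2 - ∑ k, μ.1 k ^ 2 using Nat.strong_induction_on generalizing μ with
  | _ N ih =>
    subst hN
    have hc : ∀ σ : MultiIndex m, IsRational fun α => (jackAtOne α σ)⁻¹ * jackCoeff α σ μ :=
      fun σ => (isRational_inv_jackAtOne σ).mul (isRational_jackCoeff σ μ)
    have hpos : ∀ α, 0 < α → (jackAtOne α μ)⁻¹ * jackCoeff α μ μ ≠ 0 := fun α hα => by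
      rw [jackCoeff_self]
      exact (mul_pos (inv_pos.2 (jackAtOne_pos hα μ)) (lowerHookProduct_pos hα μ)).ne'
    have hrest : IsRational fun α => ∑ σ ∈ (ofDegree m (degree μ)).erase μ,
        binomial α κ σ * ((jackAtOne α σ)⁻¹ * jackCoeff α σ μ) := by
      refine IsRational.sum _ fun σ hσ => ?_
      rw [Finset.mem_erase, mem_ofDegree] at hσ
      by_cases hd : Dominated μ σ
      · refine (ih _ ?_ σ (by omega) rfl).mul (hc σ)
        have h1 := hd.sum_sq_lt hσ.1.symm
        have h2 := sum_sq_le_degree_sq σ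
        rw [hσ.2] at h2 ⊢
        omega
      · exact (IsRational.const 0).congr fun α _ => by
          rw [jackCoeff_of_not_dominated hd]; simp
    refine (((isRational_coeffAt_shift κ μ.1).sub hrest).mul ((hc μ).inv hpos)).congr
      fun α hα => ?_
    have h1 := coeffAt_shift_normalizedJack hα κ μ (not_lt.1 hdeg)
    simp only [coeffAt_normalizedJack hα, sorted_self] at h1
    rw [h1, ← Finset.add_sum_erase _ _ (mem_ofDegree.2 rfl : μ ∈ ofDegree m (degree μ)),
      add_sub_cancel_right, mul_assoc, mul_inv_cancel₀ (hpos α hα), mul_one]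

end JackBinomial

/-- For all non-increasing multi-indices `κ, σ` of length `m`: the Jack polynomials and the
generalized binomial coefficients are well defined for every real `α > 0`; the coefficient
`(κ choose σ)_α` is nonnegative, is a rational function of `α` over `ℚ` without poles on `(0, ∞)`,
and so is a rational number for rational `α`; and the contiguous coefficients
`(σ^i choose σ)_α` are strictly positive. -/
theorem theorem2 (m : ℕ) (κ σ : JackBinomial.MultiIndex m) :
    (∀ α : ℝ, 0 < α →
      (∃! J : MvPolynomial (Fin m) ℝ, JackBinomial.IsJack α κ J) ∧
      0 < JackBinomial.jackAtOne α κ ∧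
      (∃! b : JackBinomial.MultiIndex m → ℝ, JackBinomial.IsBinomialFamily α κ b)) ∧
    (∀ α : ℝ, 0 < α → 0 ≤ JackBinomial.binomial α κ σ) ∧
    (∃ p q : Polynomial ℚ, ∀ α : ℝ, 0 < α →
      Polynomial.aeval α q ≠ 0 ∧
      JackBinomial.binomial α κ σ = Polynomial.aeval α p / Polynomial.aeval α q) ∧
    (∀ α : ℚ, 0 < α → ∃ r : ℚ, JackBinomial.binomial (α : ℝ) κ σ = (r : ℝ)) ∧
    (∀ (i : Fin m) (hi : Antitone (JackBinomial.raise σ i)) (α : ℝ), 0 < α →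
      0 < JackBinomial.binomial α ⟨JackBinomial.raise σ i, hi⟩ σ) :=
  ⟨fun _ hα => ⟨JackBinomial.existsUnique_isJack hα κ, JackBinomial.jackAtOne_pos hα κ,
      JackBinomial.existsUnique_isBinomialFamily hα κ⟩,
    fun _ hα => JackBinomial.binomial_nonneg hα κ σ,
    JackBinomial.isRational_binomial κ σ,
    fun _ hα => (JackBinomial.isRational_binomial κ σ).exists_rat hα,
    fun _ _ _ hα => JackBinomial.binomial_raise_pos hα rfl⟩
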